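/- Let $n\ge 1$. The $4n$-gon has vertex set $\mathbb Z/4n$ in cyclic order, and its edges are all unordered pairs of distinct vertices (sides and diagonals); two edges cross if their four endpoints are distinct and alternate in the cyclic order. A $2$-triangulation of the $4n$-gon is an inclusion-maximal set of edges with no three pairwise crossing edges; it is $n$-periodic if it is invariant under the rotation $i\mapsto i+n$ (rotation by $\pi/2$). For an edge $e$ let $\tilde e$ be the set consisting of $e$ and its copies under this rotation. An edge $[i,j]$ of the $4n$-gon is $2$-relevant if its length, i.e. the cyclic distance between $i$ and $j$, is greater than $2$. Two distinct $n$-periodic $2$-triangulations $T,T'$ are related by a flip if $T'=(T\setminus\tilde e)\cup\tilde f$ for some $2$-relevant $e\in T$ and some edge $f\notin T$. Let $G^n_{4n,2}$ be the graph whose vertices are the $n$-periodic $2$-triangulations of the $4n$-gon and whose edges are the pairs related by a flip. Let $\mathcal C_n$ be the half-cylinder with $n$ marked points on its boundary circle. Its universal cover has vertex set $\mathbb Z$; the edges of the cover are the unordered pairs $[u,v]$ of distinct integers, of length $|u-v|$, and two of them cross if their endpoints alternate. The edges of $\mathcal C_n$ are the classes of such pairs under simultaneous translation of both endpoints by multiples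 of $n$. A $2$-triangulation of $\mathcal C_n$ is an inclusion-maximal set $T$ of edges of $\mathcal C_n$ such that its lift (the set of all edges of the cover whose class is in $T$) contains no three pairwise crossing edges. Two distinct $2$-triangulations $T,T'$ of $\mathcal C_n$ are related by a flip if $T'=(T\setminus\{e\})\cup\{f\}$ for some $e\in T$ of length $\ell$ with $2<\ell\le 2n$ and some edge $f\notin T$. **Theorem.** The graph $G^n_{4n,2}$ is regular of degree $2(n-1)$. Equivalently, the flip graph of $2$-triangulations of $\mathcal C_n$ is regular of degree $2(n-1)$: reducing the endpoints of the edges in the lift of $T$ modulo $4n$ defines an isomorphism from the flip graph of $2$-triangulations of $\mathcal C_n$ onto $G^n_{4n,2}$. -/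

import Mathlib

namespace Multitriangulation

/-- An edge on the vertex set `V`: an unordered pair of distinct vertices.  For `V = ZMod N` these
are the edges (sides and diagonals) of the convex `N`-gon with vertices labelled in cyclic order;
for `V = ℤ` they are the edges of the infinite polygon with vertex set `ℤ`, the universal cover
of the half-cylinder. -/
def Edge (V : Type*) : Type _ := {e : Sym2 V // ¬ e.IsDiag}

section Crossings

variable {V : Type*} [CircularOrder V]

/-- Two edges cross (intersect in their interiors) when their endpoints strictly alternate in the
cyclic order of the vertices. -/
def Edge.Crosses (e f : Edge V) : Prop :=
  ∃ a b c d : V, e.1 = s(a, b) ∧ f.1 = s(c, d) ∧ sbtw a c b ∧ sbtw b d a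

/-- A `k`-crossing: a set of `k` pairwise crossing edges. -/
def IsCrossing (k : ℕ) (F : Finset (Edge V)) : Prop :=
  F.card = k ∧ (F : Set (Edge V)).Pairwise Edge.Crosses

/-- A set of edges is `k`-crossing-free when it contains no `k`-crossing. -/
def CrossingFree (k : ℕ) (T : Set (Edge V)) : Prop :=
  ∀ F : Finset (Edge V), (F : Set (Edge V)) ⊆ T → ¬ IsCrossing k F

end Crossings

section Translations

variable {V : Type*} [AddCommGroup V]

/-- The edge `e + c = [u + c, v + c]` for `e = [u, v]`. -/
def Edge.shift (c : V) (e : Edge V) : Edge V :=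
  ⟨e.1.map (· + c), fun h => e.2 ((Sym2.isDiag_map (add_left_injective c)).1 h)⟩

/-- All the translations `e + ℓ c`, `ℓ ∈ ℤ`, of an edge `e`. -/
def Edge.orbit (c : V) (e : Edge V) : Set (Edge V) :=
  {f | ∃ ℓ : ℤ, f = e.shift (ℓ • c)}

theorem Edge.shift_zero (e : Edge V) : e.shift 0 = e := by
  apply Subtype.ext
  simp [Edge.shift]

theorem Edge.shift_shift (c d : V) (e : Edge V) : (e.shift c).shift d = e.shift (c + d) := by
  apply Subtype.ext
  simp [Edge.shift, Sym2.map_map, add_assoc]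

end Translations

section Polygon

/-- The length of an edge of the `N`-gon: the number of sides on the shorter way around between
its endpoints. -/
def polyLength {N : ℕ} (e : Edge (ZMod N)) : ℕ :=
  Sym2.lift ⟨fun u v => (v - u).valMinAbs.natAbs, fun u v => by
    change (v - u).valMinAbs.natAbs = (u - v).valMinAbs.natAbs
    rw [← neg_sub, ZMod.natAbs_valMinAbs_neg]⟩ e.1

/-- A `k`-triangulation of the `N`-gon: an inclusion-maximal `(k+1)`-crossing-free set of edges. -/
def IsPolyTriangulation (N k : ℕ) (T : Set (Edge (ZMod N))) : Prop :=
  Maximal (CrossingFree (k + 1)) T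

/-- The `n`-periodic `k`-triangulations of the `N`-gon: those invariant under the rotation that
moves each vertex `n` steps further. -/
def PeriodicTriangulation (N n k : ℕ) : Type :=
  {T : Set (Edge (ZMod N)) //
    IsPolyTriangulation N k T ∧ ∀ e, e.shift (n : ZMod N) ∈ T ↔ e ∈ T}

/-- `T'` is obtained from `T` by a flip: a `k`-relevant edge of `T` is replaced, together with its
rotational copies, by an edge not in `T` together with its rotational copies. -/
def IsPolyFlip {N n k : ℕ} (T T' : PeriodicTriangulation N n k) : Prop :=
  ∃ e ∈ T.1, k < polyLength e ∧ ∃ f ∉ T.1,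
    T'.1 = (T.1 \ e.orbit (n : ZMod N)) ∪ f.orbit (n : ZMod N)

/-- The flip graph of `n`-periodic `k`-triangulations of the `N`-gon. -/
def periodicFlipGraph (N n k : ℕ) : SimpleGraph (PeriodicTriangulation N n k) :=
  SimpleGraph.fromRel IsPolyFlip

end Polygon

section HalfCylinder

/-- Two edges of the universal cover are identified when they differ by a translation by a
multiple of `n`. -/
def translationSetoid (n : ℕ) : Setoid (Edge ℤ) where
  r e f := f ∈ e.orbit (n : ℤ)
  iseqv :=
    { refl := fun e => ⟨0, by rw [zero_smul, Edge.shift_zero]⟩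
      symm := by
        rintro e _ ⟨ℓ, rfl⟩
        exact ⟨-ℓ, by rw [Edge.shift_shift, ← add_smul, add_neg_cancel, zero_smul,
          Edge.shift_zero]⟩
      trans := by
        rintro e _ _ ⟨ℓ, rfl⟩ ⟨m, rfl⟩
        exact ⟨ℓ + m, by rw [Edge.shift_shift, ← add_smul]⟩ }

/-- The edges of the half-cylinder `𝒞_n` with `n` marked points on its boundary circle. -/
def CylEdge (n : ℕ) : Type := Quotient (translationSetoid n)

/-- The covering map on edges. -/
def proj (n : ℕ) (e : Edge ℤ) : CylEdge n := Quotient.mk (translationSetoid n) e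

/-- The lift `π⁻¹(T)` of a set of edges of the half-cylinder to the universal cover. -/
def lift {n : ℕ} (T : Set (CylEdge n)) : Set (Edge ℤ) := proj n ⁻¹' T

/-- The length `|v - u|` of the edge `[u, v]` of the universal cover. -/
def coverLength (e : Edge ℤ) : ℕ :=
  Sym2.lift ⟨fun u v => (v - u).natAbs, fun u v => by
    change (v - u).natAbs = (u - v).natAbs
    rw [← neg_sub, Int.natAbs_neg]⟩ e.1

theorem coverLength_shift (c : ℤ) (e : Edge ℤ) : coverLength (e.shift c) = coverLength e := by
  obtain ⟨e, he⟩ := e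
  induction e with
  | h u v => simp [coverLength, Edge.shift]

/-- The length of an edge of the half-cylinder. -/
def cylLength {n : ℕ} (e : CylEdge n) : ℕ :=
  Quotient.lift coverLength (by rintro e _ ⟨ℓ, rfl⟩; rw [coverLength_shift]) e

/-- The `k`-triangulations of the half-cylinder: inclusion-maximal sets of edges whose lift to the
universal cover is `(k+1)`-crossing-free. -/
def CylTriangulation (n k : ℕ) : Type :=
  {T : Set (CylEdge n) // Maximal (fun S => CrossingFree (k + 1) (lift S)) T}

/-- `T'` is obtained from `T` by a flip: a `k`-relevant edge of `T` is replaced by an edge that is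
not in `T`. -/
def IsCylFlip {n k : ℕ} (T T' : CylTriangulation n k) : Prop :=
  ∃ e ∈ T.1, (k < cylLength e ∧ cylLength e ≤ k * n) ∧ ∃ f ∉ T.1, T'.1 = (T.1 \ {e}) ∪ {f}

/-- The flip graph of `k`-triangulations of the half-cylinder. -/
def cylFlipGraph (n k : ℕ) : SimpleGraph (CylTriangulation n k) :=
  SimpleGraph.fromRel IsCylFlip

end HalfCylinder

end Multitriangulation

/-!
An edge of length at most `2n` of the half-cylinder wraps onto an orbit of edges of the `4n`-gon,
and every orbit arises once, since an edge can be lifted along its shorter side. A longer edge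
crosses its translates by `n` and `2n`, so it lies in no `2`-triangulation. Under this
correspondence `2`-triangulations of the half-cylinder become sets of edges that are maximal among
the periodic ones without `3`-crossing. Such a set is maximal among all sets without `3`-crossing:
if an edge can be added but its orbit cannot, then the orbit of a quarter turn `[v, v + n]` can.

As shown by Pilaud and Santos, a `2`-triangulation is governed by its `2`-stars: every angle between
consecutive edges lies in exactly one of them. Counting angles gives exactly `2(n - 1)` orbits of
relevant edges. A relevant edge lies in two stars, and the orbit of their common bisector is the
only one that can be exchanged for its orbit without creating a `3`-crossing. As all
`2`-triangulations have equally many relevant orbits, such an exchange is a flip, so each relevant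
orbit admits exactly one.
-/

namespace Multitriangulation

section Labels

/-- A set of edges of the `N`-gon, recorded on integer labels: `P u v` says that the edge joining
the vertices `u mod N` and `v mod N` is in the set. -/
structure CyclicRel (N : ℤ) (P : ℤ → ℤ → Prop) : Prop where
  symm : ∀ {u v}, P u v → P v u
  add_right : ∀ {u v}, P u (v + N) ↔ P u v

/-- A set of edges of the `N`-gon, on integer labels, that is invariant under the rotation by `n`
vertices. -/
structure PeriodicRel (N n : ℤ) (P : ℤ → ℤ → Prop) : Prop extends CyclicRel N P where
  rot : ∀ {u v}, P (u + n) (v + n) ↔ P u v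

/-- The mirror image of a set of edges. -/
def mirrorImage (P : ℤ → ℤ → Prop) (u v : ℤ) : Prop := P (-u) (-v)

/-- A set of edges without `3`-crossing. A `3`-crossing is recorded by six labels in increasing
order within one turn, opposite labels being joined. -/
def IsFree (N : ℤ) (P : ℤ → ℤ → Prop) : Prop :=
  ∀ ⦃a₁ a₂ a₃ b₁ b₂ b₃ : ℤ⦄,
    a₁ < a₂ ∧ a₂ < a₃ ∧ a₃ < b₁ ∧ b₁ < b₂ ∧ b₂ < b₃ ∧ b₃ < a₁ + N →
    P a₁ b₁ → P a₂ b₂ → P a₃ b₃ → False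

/-- The edge `[u, v]`, where `u < v < u + N`, would form a `3`-crossing with two edges of `P`. -/
def Blocked (N : ℤ) (P : ℤ → ℤ → Prop) (u v : ℤ) : Prop :=
  ∃ a a' b b' : ℤ, (u < a ∧ a < a' ∧ a' < v ∧ v < b ∧ b < b' ∧ b' < u + N) ∧ P a b ∧ P a' b'

variable {N n u v u' v' : ℤ} {P Q : ℤ → ℤ → Prop}

theorem mirrorImage_apply : mirrorImage P u v = P (-u) (-v) := rfl

@[simp]
theorem mirrorImage_mirrorImage : mirrorImage (mirrorImage P) = P := by
  funext u v
  simp only [mirrorImage_apply, neg_neg]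

namespace CyclicRel

theorem turn (h : CyclicRel N P) (huv : P u v) : P v (u + N) := h.add_right.2 (h.symm huv)

theorem turn_back (h : CyclicRel N P) (huv : P u v) : P (v - N) u :=
  h.symm (h.add_right.1 (by rwa [sub_add_cancel]))

theorem add_right_mul (h : CyclicRel N P) (j : ℤ) : P u (v + j * N) ↔ P u v := by
  induction j using Int.induction_on with
  | zero => simp
  | succ j ih => rw [← ih, ← h.add_right (v := v + j * N)]; ring_nf
  | pred j ih => rw [← ih, ← h.add_right (v := v + (-j - 1) * N)]; ring_nf

theorem reflect (h : CyclicRel N P) : CyclicRel N (mirrorImage P) where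
  symm := h.symm
  add_right {u v} := by
    rw [mirrorImage_apply, mirrorImage_apply, ← h.add_right (v := -(v + N)), neg_add,
      neg_add_cancel_right]

theorem reflect_turn (h : CyclicRel N P) (huv : P u v) :
    mirrorImage P (-u) (N - v) := by
  rw [mirrorImage_apply, neg_neg, neg_sub]
  exact h.symm (h.turn_back huv)

theorem reflect_turn_turn (h : CyclicRel N P) (huv : P u v) :
    mirrorImage P (N - u) (N - v) := by
  rw [mirrorImage_apply, neg_sub, neg_sub]
  exact h.turn_back (h.turn_back huv)

end CyclicRel

namespace PeriodicRel

theorem rot_mul (h : PeriodicRel N n P) (j : ℤ) : P (u + j * n) (v + j * n) ↔ P u v := by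
  induction j using Int.induction_on with
  | zero => simp
  | succ j ih => rw [← ih, ← h.rot (u := u + j * n)]; ring_nf
  | pred j ih => rw [← ih, ← h.rot (u := u + (-j - 1) * n)]; ring_nf

theorem move (h : PeriodicRel N n P) (huv : P u v) (j k : ℤ) (hu : u' = u + j * n)
    (hv : v' = v + j * n + k * N) : P u' v' := by
  subst hu hv
  exact (h.add_right_mul k).2 ((h.rot_mul j).2 huv)

theorem move_symm (h : PeriodicRel N n P) (huv : P u v) (j k : ℤ) (hu : u' = v + j * n)
    (hv : v' = u + j * n + k * N) : P u' v' :=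
  h.move (h.symm huv) j k hu hv

theorem emod (h : PeriodicRel N n P) (huv : P u v) : P (u % n) (u % n + (v - u)) :=
  h.move huv (-(u / n)) 0 (by linarith [Int.emod_add_mul_ediv u n])
    (by linarith [Int.emod_add_mul_ediv u n])

theorem or (hP : PeriodicRel N n P) (hQ : PeriodicRel N n Q) :
    PeriodicRel N n (fun u v => P u v ∨ Q u v) where
  symm := Or.imp hP.symm hQ.symm
  add_right := or_congr hP.add_right hQ.add_right
  rot := or_congr hP.rot hQ.rot

theorem and_not (hP : PeriodicRel N n P) (hQ : PeriodicRel N n Q) :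
    PeriodicRel N n (fun u v => P u v ∧ ¬ Q u v) where
  symm := And.imp hP.symm (mt hQ.symm)
  add_right := and_congr hP.add_right (not_congr hQ.add_right)
  rot := and_congr hP.rot (not_congr hQ.rot)

end PeriodicRel

theorem IsFree.mono (h : IsFree N Q) (hPQ : ∀ u v, P u v → Q u v) : IsFree N P :=
  fun _ _ _ _ _ _ ho h₁ h₂ h₃ => h ho (hPQ _ _ h₁) (hPQ _ _ h₂) (hPQ _ _ h₃)

theorem IsFree.reflect (h : IsFree N P) (hP : CyclicRel N P) : IsFree N (mirrorImage P) :=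
  fun _ _ _ _ _ _ ho h₁ h₂ h₃ => h (by omega) (hP.symm h₃) (hP.symm h₂) (hP.symm h₁)

theorem IsFree.not_blocked (h : IsFree N P) (huv : P u v) : ¬ Blocked N P u v := by
  rintro ⟨a, a', b, b', ho, hab, hab'⟩
  exact h (by omega) huv hab hab'

/-- A `3`-crossing of `P ∪ Q` has one edge in `Q`, or two, which may be taken to come first. -/
theorem IsFree.or (hF : IsFree N P) (hP : CyclicRel N P) (hQ : CyclicRel N Q)
    (hone : ∀ u v, u < v → v < u + N → Q u v → ¬ Blocked N P u v)
    (htwo : ∀ a₁ a₂ a₃ b₁ b₂ b₃ : ℤ,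
      a₁ < a₂ ∧ a₂ < a₃ ∧ a₃ < b₁ ∧ b₁ < b₂ ∧ b₂ < b₃ ∧ b₃ < a₁ + N →
      Q a₁ b₁ → Q a₂ b₂ → ¬ (P a₃ b₃ ∨ Q a₃ b₃)) :
    IsFree N (fun u v => P u v ∨ Q u v) := by
  have hone' : ∀ a₁ a₂ a₃ b₁ b₂ b₃ : ℤ,
      a₁ < a₂ ∧ a₂ < a₃ ∧ a₃ < b₁ ∧ b₁ < b₂ ∧ b₂ < b₃ ∧ b₃ < a₁ + N →
      Q a₁ b₁ → P a₂ b₂ → P a₃ b₃ → False := fun a₁ a₂ a₃ b₁ b₂ b₃ ho h₁ h₂ h₃ =>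
    hone a₁ b₁ (by omega) (by omega) h₁ ⟨a₂, a₃, b₂, b₃, by omega, h₂, h₃⟩
  rintro a₁ a₂ a₃ b₁ b₂ b₃ ho (h₁ | h₁) (h₂ | h₂) h₃
  · rcases h₃ with h₃ | h₃
    · exact hF ho h₁ h₂ h₃
    · exact hone' a₃ b₁ b₂ b₃ (a₁ + N) (a₂ + N) (by omega) h₃ (hP.turn h₁) (hP.turn h₂)
  · rcases h₃ with h₃ | h₃
    · exact hone' a₂ a₃ b₁ b₂ b₃ (a₁ + N) (by omega) h₂ h₃ (hP.turn h₁)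
    · exact htwo a₂ a₃ b₁ b₂ b₃ (a₁ + N) (by omega) h₂ h₃ (Or.inl (hP.turn h₁))
  · rcases h₃ with h₃ | h₃
    · exact hone' _ _ _ _ _ _ ho h₁ h₂ h₃
    · exact htwo a₃ b₁ b₂ b₃ (a₁ + N) (a₂ + N) (by omega) h₃ (hQ.turn h₁) (Or.inl (hP.turn h₂))
  · exact htwo _ _ _ _ _ _ ho h₁ h₂ h₃

theorem Blocked.mono (h : Blocked N P u v) (hPQ : ∀ u v, P u v → Q u v) : Blocked N Q u v := by
  obtain ⟨a, a', b, b', ho, hab, hab'⟩ := h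
  exact ⟨a, a', b, b', ho, hPQ _ _ hab, hPQ _ _ hab'⟩

theorem Blocked.turn (h : Blocked N P u v) (hP : CyclicRel N P) : Blocked N P v (u + N) := by
  obtain ⟨a, a', b, b', ho, hab, hab'⟩ := h
  exact ⟨b, b', a + N, a' + N, by omega, hP.turn hab, hP.turn hab'⟩

theorem Blocked.rot (h : Blocked N P u v) (hP : PeriodicRel N n P) (t : ℤ) :
    Blocked N P (u + t * n) (v + t * n) := by
  obtain ⟨a, a', b, b', ho, hab, hab'⟩ := h
  exact ⟨a + t * n, a' + t * n, b + t * n, b' + t * n, by omega, (hP.rot_mul t).2 hab,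
    (hP.rot_mul t).2 hab'⟩

theorem Blocked.reflect (h : Blocked N P u v) (hP : CyclicRel N P) :
    Blocked N (mirrorImage P) (-v) (-u) := by
  obtain ⟨a, a', b, b', ho, hab, hab'⟩ := h
  exact ⟨-a', -a, N - b', N - b, by omega, hP.reflect_turn hab', hP.reflect_turn hab⟩

end Labels

section Stars

variable {N n : ℤ} {P : ℤ → ℤ → Prop}

/-- A `2`-triangulation of the `N`-gon on integer labels: a set of edges without `3`-crossing to
which no edge can be added. -/
structure TwoTri (N : ℤ) (P : ℤ → ℤ → Prop) : Prop extends CyclicRel N P where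
  free : IsFree N P
  blocked : ∀ {u v}, u < v → v < u + N → ¬ P u v → Blocked N P u v

/-- A `2`-star of Pilaud and Santos: the pentagram on five vertices in cyclic order. The angle of
the star at `x₀` is the one between `[x₀, x₂]` and `[x₀, x₃]`. -/
structure TwoStar (N : ℤ) (P : ℤ → ℤ → Prop) (x₀ x₁ x₂ x₃ x₄ : ℤ) : Prop where
  lt : x₀ < x₁ ∧ x₁ < x₂ ∧ x₂ < x₃ ∧ x₃ < x₄ ∧ x₄ < x₀ + N
  mem₀₂ : P x₀ x₂
  mem₀₃ : P x₀ x₃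
  mem₁₃ : P x₁ x₃
  mem₁₄ : P x₁ x₄
  mem₂₄ : P x₂ x₄

/-- The edge `[s, t]` of `P` crosses both sides `[v, w]` and `[v, u]` of the angle at `v`. -/
def CrossesAngle (N : ℤ) (P : ℤ → ℤ → Prop) (v w u s t : ℤ) : Prop :=
  (v < s ∧ s < w ∧ u < t ∧ t < v + N) ∧ P s t

namespace TwoStar

variable {x₀ x₁ x₂ x₃ x₄ y₁ y₂ y₃ y₄ y j : ℤ}

theorem rotate (h : TwoStar N P x₀ x₁ x₂ x₃ x₄) (hP : CyclicRel N P) :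
    TwoStar N P x₁ x₂ x₃ x₄ (x₀ + N) := by
  have hlt := h.lt
  exact ⟨by omega, h.mem₁₃, h.mem₁₄, h.mem₂₄, hP.turn h.mem₀₂, hP.turn h.mem₀₃⟩

theorem rotate₂ (h : TwoStar N P x₀ x₁ x₂ x₃ x₄) (hP : CyclicRel N P) :
    TwoStar N P x₂ x₃ x₄ (x₀ + N) (x₁ + N) :=
  (h.rotate hP).rotate hP

theorem rotate₃ (h : TwoStar N P x₀ x₁ x₂ x₃ x₄) (hP : CyclicRel N P) :
    TwoStar N P x₃ x₄ (x₀ + N) (x₁ + N) (x₂ + N) :=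
  (h.rotate₂ hP).rotate hP

theorem rotate₄ (h : TwoStar N P x₀ x₁ x₂ x₃ x₄) (hP : CyclicRel N P) :
    TwoStar N P x₄ (x₀ + N) (x₁ + N) (x₂ + N) (x₃ + N) :=
  (h.rotate₃ hP).rotate hP

theorem translate (h : TwoStar N P x₀ x₁ x₂ x₃ x₄) (hP : PeriodicRel N n P) (t : ℤ) :
    TwoStar N P (x₀ + t * n) (x₁ + t * n) (x₂ + t * n) (x₃ + t * n) (x₄ + t * n) := by
  have hlt := h.lt
  exact ⟨by omega, (hP.rot_mul t).2 h.mem₀₂, (hP.rot_mul t).2 h.mem₀₃, (hP.rot_mul t).2 h.mem₁₃,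
    (hP.rot_mul t).2 h.mem₁₄, (hP.rot_mul t).2 h.mem₂₄⟩

theorem reflect (h : TwoStar N P x₀ x₁ x₂ x₃ x₄) (hP : CyclicRel N P) :
    TwoStar N (mirrorImage P) (-x₀) (N - x₄) (N - x₃) (N - x₂) (N - x₁) := by
  have hlt := h.lt
  exact ⟨by omega, hP.reflect_turn h.mem₀₃, hP.reflect_turn h.mem₀₂,
    hP.reflect_turn_turn (hP.symm h.mem₂₄), hP.reflect_turn_turn (hP.symm h.mem₁₄),
    hP.reflect_turn_turn (hP.symm h.mem₁₃)⟩

theorem not_bisected (h : TwoStar N P x₀ x₁ x₂ x₃ x₄) (hF : IsFree N P) (hy : x₂ < y)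
    (hy' : y < x₃) : ¬ P x₀ y := fun hxy => by
  have hlt := h.lt
  exact hF (by omega) hxy h.mem₁₃ h.mem₂₄

theorem unique (h : TwoStar N P x₀ x₁ x₂ x₃ x₄) (h' : TwoStar N P x₀ y₁ y₂ y₃ y₄)
    (hF : IsFree N P) (hj : x₂ ≤ j ∧ j < x₃) (hj' : y₂ ≤ j ∧ j < y₃) :
    x₁ = y₁ ∧ x₂ = y₂ ∧ x₃ = y₃ ∧ x₄ = y₄ := by
  have hlt := h.lt
  have hlt' := h'.lt
  obtain rfl : x₂ = y₂ := by
    rcases lt_trichotomy x₂ y₂ with hne | he | hne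
    · exact (h.not_bisected hF hne (by omega) h'.mem₀₂).elim
    · exact he
    · exact (h'.not_bisected hF hne (by omega) h.mem₀₂).elim
  obtain rfl : x₃ = y₃ := by
    rcases lt_trichotomy x₃ y₃ with hne | he | hne
    · exact (h'.not_bisected hF (by omega) hne h.mem₀₃).elim
    · exact he
    · exact (h.not_bisected hF (by omega) hne h'.mem₀₃).elim
  refine ⟨?_, rfl, rfl, ?_⟩
  · rcases lt_trichotomy x₁ y₁ with hne | he | hne
    · exact (hF (by omega) h.mem₀₂ h.mem₁₃ h'.mem₁₄).elim
    · exact he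
    · exact (hF (by omega) h.mem₀₂ h'.mem₁₃ h.mem₁₄).elim
  · rcases lt_trichotomy x₄ y₄ with hne | he | hne
    · exact (hF (by omega) h.mem₀₃ h.mem₁₄ h'.mem₂₄).elim
    · exact he
    · exact (hF (by omega) h.mem₀₃ h'.mem₁₄ h.mem₂₄).elim

end TwoStar

namespace TwoTri

variable {u v w s t j : ℤ}

theorem reflect (h : TwoTri N P) : TwoTri N (mirrorImage P) where
  toCyclicRel := h.toCyclicRel.reflect
  free := h.free.reflect h.toCyclicRel
  blocked {u v} huv hvu hno := by
    simpa using (h.blocked (u := -v) (v := -u) (by omega) (by omega)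
      (fun hc => hno (h.symm hc))).reflect h.toCyclicRel

theorem mem_of_short (h : TwoTri N P) (huv : u < v) (hvu : v < u + N)
    (hshort : v ≤ u + 2 ∨ u + N ≤ v + 2) : P u v := by
  by_contra hno
  obtain ⟨a, a', b, b', ho, -⟩ := h.blocked huv hvu hno
  omega

theorem exists_shortest_crossesAngle (h : TwoTri N P) (hw : v + 2 ≤ w) (hwu : w < u)
    (hu : u ≤ v + N - 2) : ∃ s t, CrossesAngle N P v w u s t ∧
      ∀ a b, CrossesAngle N P v w u a b → t - s ≤ b - a := by
  have hne : {p : ℤ × ℤ | CrossesAngle N P v w u p.1 p.2}.Nonempty :=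
    ⟨(v + 1, v + N - 1), by dsimp; omega, h.mem_of_short (by omega) (by omega) (by omega)⟩
  obtain ⟨⟨s, t⟩, hst, hmin⟩ :=
    (measure fun p : ℤ × ℤ => (p.2 - p.1).toNat).wf.has_min _ hne
  refine ⟨s, t, hst, fun a b hab => ?_⟩
  have hle : (t - s).toNat ≤ (b - a).toNat := not_lt.1 (hmin (a, b) hab)
  have hlt := hst.1
  dsimp at hle hlt
  omega

theorem mem_of_shortest_crossesAngle (h : TwoTri N P) (hw : v + 2 ≤ w) (hwu : w < u)
    (hu : u ≤ v + N - 2) (hvw : P v w) (hvu : P v u) (hno : ∀ x, w < x → x < u → ¬ P v x)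
    (hst : CrossesAngle N P v w u s t)
    (hmin : ∀ a b, CrossesAngle N P v w u a b → t - s ≤ b - a) : P s u := by
  by_contra hsu
  have hF := h.free
  obtain ⟨⟨hs, hsw, hut, ht⟩, hst⟩ := hst
  obtain ⟨c, c', d, d', ho, hcd, hcd'⟩ := h.blocked (by omega) (by omega) hsu
  have hd' : v + N ≤ d' := by
    by_contra
    exact hF (by omega) hvu hcd hcd'
  have hd : d ≤ t := by
    by_contra
    exact hF (by omega) hst hcd hcd'
  have hc : w ≤ c := by
    by_contra
    have := hmin c d ⟨by omega, hcd⟩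
    omega
  have hc'v : P (d' - N) c' := h.turn_back hcd'
  have hne : d' - N ≠ v := by
    rintro rfl
    exact hno c' (by omega) (by omega) hc'v
  exact hF (by omega) hvw hc'v hst

/-- Two consecutive edges at a vertex are completed to a star by the shortest edge crossing both
of them. -/
theorem exists_star_of_angle (h : TwoTri N P) (hw : v + 2 ≤ w) (hwu : w < u)
    (hu : u ≤ v + N - 2) (hvw : P v w) (hvu : P v u) (hno : ∀ x, w < x → x < u → ¬ P v x) :
    ∃ s t, TwoStar N P v s w u t := by
  obtain ⟨s, t, hst, hmin⟩ := h.exists_shortest_crossesAngle hw hwu hu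
  have hsu : P s u := h.mem_of_shortest_crossesAngle hw hwu hu hvw hvu hno hst hmin
  have hlt := hst.1
  have htw : mirrorImage P (N - t) (N - w) := by
    refine h.reflect.mem_of_shortest_crossesAngle (v := -v) (w := N - u) (t := N - s) (by omega)
      (by omega) (by omega) (h.reflect_turn hvu) (h.reflect_turn hvw) ?_
      ⟨by omega, h.reflect_turn_turn (h.symm hst.2)⟩ ?_
    · intro x hx hx' hvx
      rw [mirrorImage_apply, neg_neg] at hvx
      refine hno (N - x) (by omega) (by omega) ?_
      rw [sub_eq_neg_add, h.add_right]
      exact hvx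
    · rintro a b ⟨hab, hmem⟩
      have := hmin (N - b) (N - a) ⟨by omega, by
        simpa using h.reflect.reflect_turn_turn (h.reflect.symm hmem)⟩
      omega
  have hwt : P w t := by simpa using h.reflect.reflect_turn_turn (h.reflect.symm htw)
  exact ⟨s, t, by omega, hvw, hvu, hsu, hst.2, hwt⟩

theorem exists_star (h : TwoTri N P) (hv : v + 2 ≤ j) (hj : j < v + N - 2) :
    ∃ s w u t, TwoStar N P v s w u t ∧ w ≤ j ∧ j < u := by
  have hfirst : P v (v + 2) := h.mem_of_short (by omega) (by omega) (by omega)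
  have hlast : P v (v + N - 2) := h.mem_of_short (by omega) (by omega) (by omega)
  obtain ⟨w, ⟨hwj, hvw⟩, hmax⟩ := Int.exists_greatest_of_bdd (P := fun x => x ≤ j ∧ P v x)
    ⟨j, fun z hz => hz.1⟩ ⟨v + 2, hv, hfirst⟩
  obtain ⟨u, ⟨hju, hvu⟩, hmin⟩ := Int.exists_least_of_bdd (P := fun x => j < x ∧ P v x)
    ⟨j, fun z hz => hz.1.le⟩ ⟨v + N - 2, hj, hlast⟩
  have hno : ∀ x, w < x → x < u → ¬ P v x := fun x hwx hxu hvx => by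
    rcases le_or_gt x j with hxj | hxj
    · exact (hmax x ⟨hxj, hvx⟩).not_gt hwx
    · exact (hmin x ⟨hxj, hvx⟩).not_gt hxu
  obtain ⟨s, t, hst⟩ := h.exists_star_of_angle (hmax _ ⟨hv, hfirst⟩) (by omega)
    (hmin _ ⟨hj, hlast⟩) hvw hvu hno
  exact ⟨s, w, u, t, hst, hwj, hju⟩

theorem exists_star_mem₀₂ (h : TwoTri N P) (hv : u + 2 ≤ v) (hv' : v ≤ u + N - 3)
    (huv : P u v) : ∃ s x t, TwoStar N P u s v x t := by
  obtain ⟨s, w, x, t, hst, hwv, hvx⟩ := h.exists_star hv (by omega)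
  obtain rfl : w = v := by
    by_contra hne
    exact hst.not_bisected h.free (by omega) hvx huv
  exact ⟨s, x, t, hst⟩

theorem exists_star_mem₀₃ (h : TwoTri N P) (hv : u + 3 ≤ v) (hv' : v ≤ u + N - 2)
    (huv : P u v) : ∃ s w t, TwoStar N P u s w v t := by
  obtain ⟨s, w, x, t, hst, hwv, hvx⟩ := h.exists_star (v := u) (j := v - 1) (by omega) (by omega)
  obtain rfl : x = v := by
    by_contra hne
    exact hst.not_bisected h.free (y := v) (by omega) (by omega) huv
  exact ⟨s, w, t, hst⟩

end TwoTri

end Stars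

section Counting

variable {N n u v ℓ : ℤ} {P : ℤ → ℤ → Prop} {α : ℤ × ℤ} {x₀ x₁ x₂ x₃ x₄ y₀ y₁ y₂ y₃ y₄ : ℤ}

open Classical in
/-- The edges `[v, v + ℓ]` of `P` with `0 ≤ v < n` and `ℓ ∈ S`, recorded as pairs `(v, ℓ)`. They
represent the orbits, under rotation by `n` vertices, of the edges of `P` with a length in `S`. -/
noncomputable def edgesOfLength (n : ℤ) (P : ℤ → ℤ → Prop) (S : Finset ℤ) : Finset (ℤ × ℤ) :=
  {p ∈ Finset.Ico 0 n ×ˢ S | P p.1 (p.1 + p.2)}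

open Classical in
/-- The number of edges `[v, v + ℓ]` of `P` with `0 ≤ v < n`. -/
noncomputable def lengthCount (n : ℤ) (P : ℤ → ℤ → Prop) (ℓ : ℤ) : ℕ :=
  {v ∈ Finset.Ico 0 n | P v (v + ℓ)}.card

theorem mem_edgesOfLength {S : Finset ℤ} :
    α ∈ edgesOfLength n P S ↔ ((0 ≤ α.1 ∧ α.1 < n) ∧ α.2 ∈ S) ∧ P α.1 (α.1 + α.2) := by
  simp only [edgesOfLength, Finset.mem_filter, Finset.mem_product, Finset.mem_Ico]

theorem card_edgesOfLength (S : Finset ℤ) :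
    (edgesOfLength n P S).card = ∑ ℓ ∈ S, lengthCount n P ℓ := by
  simp only [edgesOfLength, lengthCount, Finset.card_filter]
  exact Finset.sum_product_right ..

/-- The angles of `P`, up to rotation by `n` vertices: `(v, ℓ)` stands for the angle at `v` between
`v + ℓ` and the next neighbour of `v`. -/
noncomputable def angles (N n : ℤ) (P : ℤ → ℤ → Prop) : Finset (ℤ × ℤ) :=
  edgesOfLength n P (Finset.Icc 2 (N - 3))

theorem mem_angles : α ∈ angles N n P ↔
    ((0 ≤ α.1 ∧ α.1 < n) ∧ 2 ≤ α.2 ∧ α.2 ≤ N - 3) ∧ P α.1 (α.1 + α.2) := by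
  rw [angles, mem_edgesOfLength, Finset.mem_Icc]

/-- The star `x` contains the angle `α`, up to rotation by multiples of `n`, as its angle at
`x₀`. -/
def StarAt (N n : ℤ) (P : ℤ → ℤ → Prop) (α : ℤ × ℤ) (x₀ x₁ x₂ x₃ x₄ : ℤ) : Prop :=
  TwoStar N P x₀ x₁ x₂ x₃ x₄ ∧ α = (x₀ % n, x₂ - x₀)

namespace StarAt

theorem unique (h : StarAt N n P α x₀ x₁ x₂ x₃ x₄) (h' : StarAt N n P α y₀ y₁ y₂ y₃ y₄)
    (hP : PeriodicRel N n P) (hF : IsFree N P) : ∃ t, y₀ = x₀ + t * n ∧ y₁ = x₁ + t * n ∧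
      y₂ = x₂ + t * n ∧ y₃ = x₃ + t * n ∧ y₄ = x₄ + t * n := by
  obtain ⟨hx, rfl⟩ := h
  obtain ⟨hy, he⟩ := h'
  obtain ⟨hmod, hsub⟩ := Prod.mk.inj he
  obtain ⟨t, ht⟩ : n ∣ y₀ - x₀ := Int.ModEq.dvd hmod
  obtain rfl : y₀ = x₀ + t * n := by linarith
  have hlt := hx.lt
  have hlt' := hy.lt
  obtain ⟨h₁, h₂, h₃, h₄⟩ := (hx.translate hP t).unique hy hF (j := y₂) (by omega) (by omega)
  exact ⟨t, rfl, h₁.symm, h₂.symm, h₃.symm, h₄.symm⟩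

theorem rotate (h : StarAt N n P α x₀ x₁ x₂ x₃ x₄) (hP : CyclicRel N P) :
    StarAt N n P (x₁ % n, x₃ - x₁) x₁ x₂ x₃ x₄ (x₀ + N) :=
  ⟨h.1.rotate hP, rfl⟩

theorem mem_angles (h : StarAt N n P α x₀ x₁ x₂ x₃ x₄) (hP : PeriodicRel N n P) (hn : 0 < n) :
    α ∈ angles N n P := by
  obtain ⟨hs, rfl⟩ := h
  have hlt := hs.lt
  exact Multitriangulation.mem_angles.2 ⟨⟨⟨Int.emod_nonneg _ hn.ne', Int.emod_lt_of_pos _ hn⟩,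
    by dsimp; omega, by dsimp; omega⟩, hP.emod hs.mem₀₂⟩

end StarAt

theorem TwoTri.exists_starAt (h : TwoTri N P) (hα : α ∈ angles N n P) :
    ∃ s x t, StarAt N n P α α.1 s (α.1 + α.2) x t := by
  rw [mem_angles] at hα
  obtain ⟨s, x, t, hst⟩ := h.exists_star_mem₀₂ (by omega) (by omega) hα.2
  exact ⟨s, x, t, hst, by rw [Int.emod_eq_of_lt hα.1.1.1 hα.1.1.2, add_sub_cancel_left]⟩

/-- `g α` is the number of sides of the polygon seen from the angle `α`. -/
def IsGap (N n : ℤ) (P : ℤ → ℤ → Prop) (g : ℤ × ℤ → ℤ) : Prop :=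
  ∀ ⦃α x₀ x₁ x₂ x₃ x₄⦄, StarAt N n P α x₀ x₁ x₂ x₃ x₄ → g α = x₃ - x₂

theorem exists_isGap (hP : PeriodicRel N n P) (hF : IsFree N P) : ∃ g, IsGap N n P g := by
  have hgap : ∀ α, ∃ d, ∀ x₀ x₁ x₂ x₃ x₄, StarAt N n P α x₀ x₁ x₂ x₃ x₄ → d = x₃ - x₂ := fun α => by
    by_cases hstar : ∃ x₀ x₁ x₂ x₃ x₄, StarAt N n P α x₀ x₁ x₂ x₃ x₄
    · obtain ⟨x₀, x₁, x₂, x₃, x₄, hx⟩ := hstar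
      refine ⟨x₃ - x₂, fun y₀ y₁ y₂ y₃ y₄ hy => ?_⟩
      obtain ⟨t, -, -, rfl, rfl, -⟩ := hx.unique hy hP hF
      ring
    · push Not at hstar
      exact ⟨0, fun _ _ _ _ _ hx => (hstar _ _ _ _ _ hx).elim⟩
  choose g hg using hgap
  exact ⟨g, fun α x₀ x₁ x₂ x₃ x₄ => hg α x₀ x₁ x₂ x₃ x₄⟩

theorem TwoTri.exists_perm_angles (h : TwoTri N P) (hP : PeriodicRel N n P) (hn : 0 < n) :
    ∃ σ : Equiv.Perm (angles N n P), ∀ (α : angles N n P) (x₀ x₁ x₂ x₃ x₄ : ℤ),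
      StarAt N n P α x₀ x₁ x₂ x₃ x₄ → StarAt N n P (σ α) x₁ x₂ x₃ x₄ (x₀ + N) := by
  have hnext : ∀ α : angles N n P, ∃ β : angles N n P, ∀ x₀ x₁ x₂ x₃ x₄,
      StarAt N n P α x₀ x₁ x₂ x₃ x₄ → StarAt N n P β x₁ x₂ x₃ x₄ (x₀ + N) := fun α => by
    obtain ⟨s, x, t, hst⟩ := h.exists_starAt α.2
    have hrot := hst.rotate hP.toCyclicRel
    refine ⟨⟨_, hrot.mem_angles hP hn⟩, fun y₀ y₁ y₂ y₃ y₄ hy => ?_⟩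
    obtain ⟨j, -, rfl, -, rfl, -⟩ := hst.unique hy hP h.free
    refine ⟨hy.1.rotate hP.toCyclicRel, ?_⟩
    rw [Int.add_mul_emod_self_right, add_sub_add_right_eq_sub]
  choose f hf using hnext
  have hinj : Function.Injective f := fun α β hαβ => by
    obtain ⟨s, x, t, hα⟩ := h.exists_starAt α.2
    obtain ⟨s', x', t', hβ⟩ := h.exists_starAt β.2
    obtain ⟨j, -, hj₁, -, -, hj₄⟩ :=
      (hf α _ _ _ _ _ hα).unique (hαβ ▸ hf β _ _ _ _ _ hβ) hP h.free
    ext1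
    rw [hα.2, hβ.2, hj₁, show β.1.1 = α.1.1 + j * n by linarith, Int.add_mul_emod_self_right,
      add_sub_add_right_eq_sub]
  exact ⟨Equiv.ofBijective f (Finite.injective_iff_bijective.1 hinj), hf⟩

theorem TwoTri.five_mul_sum_gap (h : TwoTri N P) (hP : PeriodicRel N n P) (hn : 0 < n)
    {g : ℤ × ℤ → ℤ} (hg : IsGap N n P g) :
    5 * ∑ α ∈ angles N n P, g α = N * (angles N n P).card := by
  obtain ⟨σ, hσ⟩ := h.exists_perm_angles hP hn
  have hturn (α : angles N n P) : ∑ i ∈ Finset.range 5, g ((σ ^ i) α) = N := by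
    obtain ⟨s, x, t, h₀⟩ := h.exists_starAt α.2
    have h₁ := hσ _ _ _ _ _ _ h₀
    have h₂ := hσ _ _ _ _ _ _ h₁
    have h₃ := hσ _ _ _ _ _ _ h₂
    have h₄ := hσ _ _ _ _ _ _ h₃
    simp only [Finset.sum_range_succ, Finset.sum_range_zero, pow_succ', pow_zero,
      Equiv.Perm.mul_apply, Equiv.Perm.one_apply, hg h₀, hg h₁, hg h₂, hg h₃, hg h₄]
    ring
  calc 5 * ∑ α ∈ angles N n P, g α
      = ∑ i ∈ Finset.range 5, ∑ α : angles N n P, g ((σ ^ i) α) := by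
        simp only [Equiv.sum_comp (σ ^ _) fun α : angles N n P => g α, Finset.sum_coe_sort,
          Finset.sum_const, Finset.card_range, nsmul_eq_mul, Nat.cast_ofNat]
    _ = N * (angles N n P).card := by
        rw [Finset.sum_comm, Finset.sum_congr rfl fun α _ => hturn α, Finset.sum_const,
          Finset.card_univ, Fintype.card_coe, nsmul_eq_mul, mul_comm]

/-- The sides seen from a vertex `v`, except for the two at each end, are distributed among the
angles at `v`. -/
theorem TwoTri.biUnion_angles (h : TwoTri N P) (hP : PeriodicRel N n P)
    {g : ℤ × ℤ → ℤ} (hg : IsGap N n P g) :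
    (angles N n P).biUnion (fun α => {α.1} ×ˢ Finset.Ico α.2 (α.2 + g α)) =
      Finset.Ico 0 n ×ˢ Finset.Ico 2 (N - 2) := by
  ext ⟨v, j⟩
  simp only [Finset.mem_biUnion, Finset.mem_product, Finset.mem_singleton, Finset.mem_Ico]
  constructor
  · rintro ⟨α, hα, rfl, hj⟩
    obtain ⟨s, x, t, hst⟩ := h.exists_starAt hα
    have hlt := hst.1.lt
    have hgα := hg hst
    have hbound := (mem_angles.1 hα).1
    omega
  · rintro ⟨hv, hj⟩
    obtain ⟨s, w, u, t, hst, hw, hu⟩ := h.exists_star (v := v) (j := v + j) (by omega) (by omega)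
    have hα : StarAt N n P (v, w - v) v s w u t := ⟨hst, by rw [Int.emod_eq_of_lt hv.1 hv.2]⟩
    refine ⟨_, hα.mem_angles hP (by omega), rfl, ?_⟩
    rw [hg hα]
    dsimp
    omega

theorem TwoTri.sum_gap (h : TwoTri N P) (hP : PeriodicRel N n P) (hn : 0 < n) (hN : 4 ≤ N)
    {g : ℤ × ℤ → ℤ} (hg : IsGap N n P g) : ∑ α ∈ angles N n P, g α = n * (N - 4) := by
  have hdisj : (angles N n P : Set (ℤ × ℤ)).PairwiseDisjoint
      (fun α => ({α.1} : Finset ℤ) ×ˢ Finset.Ico α.2 (α.2 + g α)) := by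
    intro α hα β hβ hne
    refine Finset.disjoint_left.2 fun ⟨v, j⟩ hvα hvβ => hne ?_
    simp only [Finset.mem_product, Finset.mem_singleton, Finset.mem_Ico] at hvα hvβ
    obtain ⟨s, x, t, hst⟩ := h.exists_starAt hα
    obtain ⟨s', x', t', hst'⟩ := h.exists_starAt hβ
    have hgα := hg hst
    have hgβ := hg hst'
    have hv : α.1 = β.1 := by omega
    have hstar := hst'.1
    rw [← hv] at hstar hgβ
    obtain ⟨-, hw, -⟩ := hst.1.unique hstar h.free (j := α.1 + j) (by omega) (by omega)
    exact Prod.ext hv (by omega)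
  have hcard := congrArg (fun s => (s.card : ℤ)) (h.biUnion_angles hP hg)
  simp only [Finset.card_biUnion hdisj, Finset.card_product, Finset.card_singleton, Int.card_Ico,
    one_mul, Nat.cast_sum, Nat.cast_mul, sub_zero, Int.toNat_of_nonneg hn.le] at hcard
  rw [Int.toNat_of_nonneg (by omega)] at hcard
  calc ∑ α ∈ angles N n P, g α = ∑ α ∈ angles N n P, ((α.2 + g α - α.2).toNat : ℤ) := by
        refine Finset.sum_congr rfl fun α hα => ?_
        obtain ⟨s, x, t, hst⟩ := h.exists_starAt hα
        have hlt := hst.1.lt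
        have hgα := hg hst
        omega
    _ = n * (N - 4) := by rw [hcard]; ring

theorem TwoTri.card_angles (h : TwoTri N P) (hP : PeriodicRel N n P) (hn : 0 < n) (hN : 4 ≤ N) :
    N * (angles N n P).card = 5 * (n * (N - 4)) := by
  obtain ⟨g, hg⟩ := exists_isGap hP h.free
  rw [← h.five_mul_sum_gap hP hn hg, h.sum_gap hP hn hN hg]

theorem lengthCount_symm (hP : PeriodicRel N n P) (hn : 0 < n) (hN : n ∣ N) (ℓ : ℤ) :
    lengthCount n P (N - ℓ) = lengthCount n P ℓ := by
  have hmaps : ∀ k v, 0 ≤ v ∧ v < n → P v (v + k) →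
      (0 ≤ (v + k) % n ∧ (v + k) % n < n) ∧ P ((v + k) % n) ((v + k) % n + (N - k)) :=
    fun k v _ hvk => ⟨⟨Int.emod_nonneg _ hn.ne', Int.emod_lt_of_pos _ hn⟩, by
      simpa only [add_sub_add_left_eq_sub] using hP.emod (hP.turn hvk)⟩
  have hinv : ∀ k v, 0 ≤ v ∧ v < n → ((v + k) % n + (N - k)) % n = v := fun k v hv => by
    rw [Int.emod_add_emod, show v + k + (N - k) = v + N by ring, Int.add_emod,
      Int.emod_eq_zero_of_dvd hN, add_zero, Int.emod_emod, Int.emod_eq_of_lt hv.1 hv.2]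
  refine Finset.card_bij' (fun v _ => (v + (N - ℓ)) % n) (fun v _ => (v + ℓ) % n) ?_ ?_ ?_ ?_ <;>
    simp only [Finset.mem_filter, Finset.mem_Ico]
  · rintro v ⟨hv, hvP⟩
    simpa only [sub_sub_cancel] using hmaps (N - ℓ) v hv hvP
  · exact fun v hv => hmaps ℓ v hv.1 hv.2
  · rintro v ⟨hv, -⟩
    simpa only [sub_sub_cancel] using hinv (N - ℓ) v hv
  · exact fun v hv => hinv ℓ v hv.1

/-- Two diameters and the quarter turn of one of them form a `3`-crossing. -/
theorem IsFree.diameter_unique (hF : IsFree (4 * n) P) (hP : PeriodicRel (4 * n) n P)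
    (hu : P u (u + 2 * n)) (hv : P v (v + 2 * n)) (huv : u < v) : u + n ≤ v := by
  by_contra! hvu
  exact hF (by omega) hu hv (hP.move hu 1 0 (by ring) (by ring) : P (u + n) (u + 3 * n))

theorem lengthCount_diameter_le (hF : IsFree (4 * n) P) (hP : PeriodicRel (4 * n) n P) :
    lengthCount n P (2 * n) ≤ 1 := by
  rw [lengthCount, Finset.card_le_one]
  simp only [Finset.mem_filter, Finset.mem_Ico]
  rintro u ⟨hu, hPu⟩ v ⟨hv, hPv⟩
  rcases lt_trichotomy u v with huv | rfl | hvu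
  · have := hF.diameter_unique hP hPu hPv huv
    omega
  · rfl
  · have := hF.diameter_unique hP hPv hPu hvu
    omega

theorem sum_Icc_two_eq (f : ℤ → ℕ) (hf : ∀ ℓ, f (4 * n - ℓ) = f ℓ) (hn : 2 ≤ n) :
    ∑ ℓ ∈ Finset.Icc 2 (4 * n - 3), f ℓ + f (2 * n) =
      f 2 + 2 * ∑ ℓ ∈ Finset.Icc 3 (2 * n), f ℓ := by
  have hsplit : Finset.Icc 2 (4 * n - 3) =
      insert 2 (Finset.Icc 3 (2 * n) ∪ Finset.Icc (2 * n + 1) (4 * n - 3)) := by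
    ext x
    simp only [Finset.mem_Icc, Finset.mem_insert, Finset.mem_union]
    omega
  have hdiam : Finset.Icc 3 (2 * n) = insert (2 * n) (Finset.Icc 3 (2 * n - 1)) := by
    ext x
    simp only [Finset.mem_Icc, Finset.mem_insert]
    omega
  have hdisj : Disjoint (Finset.Icc 3 (2 * n)) (Finset.Icc (2 * n + 1) (4 * n - 3)) := by
    rw [Finset.disjoint_left]
    intro x
    simp only [Finset.mem_Icc]
    omega
  have hmirror : ∑ ℓ ∈ Finset.Icc (2 * n + 1) (4 * n - 3), f ℓ =
      ∑ ℓ ∈ Finset.Icc 3 (2 * n - 1), f ℓ := by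
    refine Finset.sum_nbij' (4 * n - ·) (4 * n - ·) ?_ ?_ ?_ ?_ fun ℓ _ => (hf ℓ).symm <;>
      (intro ℓ; simp only [Finset.mem_Icc]; omega)
  have htwo : (2 : ℤ) ∉ Finset.Icc 3 (2 * n) ∪ Finset.Icc (2 * n + 1) (4 * n - 3) := by
    simp only [Finset.mem_Icc, Finset.mem_union]
    omega
  rw [hsplit, Finset.sum_insert htwo, Finset.sum_union hdisj, hmirror, hdiam,
    Finset.sum_insert (by simp)]
  ring

/-- The orbits of relevant edges, represented by an endpoint in `[0, n)` and a length. -/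
noncomputable def relevantEdges (n : ℤ) (P : ℤ → ℤ → Prop) : Finset (ℤ × ℤ) :=
  edgesOfLength n P (Finset.Icc 3 (2 * n))

theorem mem_relevantEdges : α ∈ relevantEdges n P ↔
    ((0 ≤ α.1 ∧ α.1 < n) ∧ 3 ≤ α.2 ∧ α.2 ≤ 2 * n) ∧ P α.1 (α.1 + α.2) := by
  rw [relevantEdges, mem_edgesOfLength, Finset.mem_Icc]

open Classical in
theorem TwoTri.lengthCount_two (h : TwoTri (4 * n) P) (hn : 0 < n) :
    lengthCount n P 2 = n.toNat := by
  rw [lengthCount, Finset.filter_true_of_mem, Int.card_Ico, sub_zero]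
  exact fun v _ => h.mem_of_short (by omega) (by omega) (by omega)

/-- Counting angles determines twice the number of relevant edges up to the diameters, of which
there is at most one orbit. -/
theorem TwoTri.card_relevantEdges (h : TwoTri (4 * n) P) (hP : PeriodicRel (4 * n) n P)
    (hn : 0 < n) : ((relevantEdges n P).card : ℤ) = 2 * (n - 1) := by
  have hangles : ((angles (4 * n) n P).card : ℤ) = 5 * (n - 1) := by
    have := h.card_angles hP hn (by omega)
    exact mul_left_cancel₀ (by omega : 4 * n ≠ 0) (by rw [this]; ring)
  rw [angles, card_edgesOfLength] at hangles
  rw [relevantEdges, card_edgesOfLength]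
  obtain rfl | hn' := (show 1 ≤ n from hn).eq_or_lt
  · simp
  · have hsum := sum_Icc_two_eq (lengthCount n P)
      (lengthCount_symm hP hn (Dvd.intro_left 4 rfl)) hn'
    have hdiam := lengthCount_diameter_le h.free hP
    rw [h.lengthCount_two hn] at hsum
    omega

end Counting

section Orbits

variable {n p r p' r' u v a b x y : ℤ} {P R : ℤ → ℤ → Prop}

/-- `[u, v]` is a copy of the edge `[p, r]` of the `4n`-gon under rotation by multiples of `n`. -/
def InOrbit (n p r u v : ℤ) : Prop :=
  ∃ j k : ℤ, (u = p + j * n ∧ v = r + j * n + k * (4 * n)) ∨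
    (u = r + j * n ∧ v = p + j * n + k * (4 * n))

namespace InOrbit

theorem refl (n p r : ℤ) : InOrbit n p r p r := ⟨0, 0, Or.inl ⟨by ring, by ring⟩⟩

theorem periodicRel (n p r : ℤ) : PeriodicRel (4 * n) n (InOrbit n p r) where
  symm := by
    rintro u v ⟨j, k, ⟨rfl, rfl⟩ | ⟨rfl, rfl⟩⟩
    · exact ⟨j + 4 * k, -k, Or.inr ⟨by ring, by ring⟩⟩
    · exact ⟨j + 4 * k, -k, Or.inl ⟨by ring, by ring⟩⟩
  add_right {u v} := by
    refine ⟨fun ⟨j, k, h⟩ => ⟨j, k - 1, ?_⟩, fun ⟨j, k, h⟩ => ⟨j, k + 1, ?_⟩⟩ <;>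
      exact h.imp (And.imp_right fun h => by linarith) (And.imp_right fun h => by linarith)
  rot {u v} := by
    refine ⟨fun ⟨j, k, h⟩ => ⟨j - 1, k, ?_⟩, fun ⟨j, k, h⟩ => ⟨j + 1, k, ?_⟩⟩ <;>
      exact h.imp (And.imp (fun h => by linarith) fun h => by linarith)
        (And.imp (fun h => by linarith) fun h => by linarith)

theorem of_periodicRel (h : InOrbit n p r u v) (hR : PeriodicRel (4 * n) n R) (hpr : R p r) :
    R u v := by
  obtain ⟨j, k, ⟨rfl, rfl⟩ | ⟨rfl, rfl⟩⟩ := h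
  · exact hR.move hpr j k rfl rfl
  · exact hR.move_symm hpr j k rfl rfl

theorem symm (h : InOrbit n p r p' r') : InOrbit n p' r' p r := by
  obtain ⟨j, k, ⟨rfl, rfl⟩ | ⟨rfl, rfl⟩⟩ := h
  · exact ⟨-j, -k, Or.inl ⟨by ring, by ring⟩⟩
  · exact ⟨-j - 4 * k, k, Or.inr ⟨by ring, by ring⟩⟩

theorem trans (h : InOrbit n p r p' r') (h' : InOrbit n p' r' u v) : InOrbit n p r u v :=
  h'.of_periodicRel (periodicRel n p r) h

theorem eq (h : InOrbit n p r p' r') : InOrbit n p' r' = InOrbit n p r := by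
  funext u v
  exact propext ⟨h.trans, h.symm.trans⟩

end InOrbit

theorem inOrbit_turn (n p r : ℤ) : InOrbit n r (p + 4 * n) = InOrbit n p r :=
  InOrbit.eq ((InOrbit.periodicRel n p r).turn (InOrbit.refl n p r))

theorem mirrorImage_inOrbit (n p r : ℤ) :
    mirrorImage (InOrbit n p r) = InOrbit n (-r) (-p) := by
  funext u v
  refine propext ⟨fun ⟨j, k, h⟩ => ⟨-j, -k, ?_⟩, fun ⟨j, k, h⟩ => ⟨-j, -k, ?_⟩⟩ <;>
    rcases h with ⟨h₁, h₂⟩ | ⟨h₁, h₂⟩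
  · exact Or.inr ⟨by linarith, by linarith⟩
  · exact Or.inl ⟨by linarith, by linarith⟩
  · exact Or.inr ⟨by linarith, by linarith⟩
  · exact Or.inl ⟨by linarith, by linarith⟩

theorem eq_of_mul_lt_mul {t : ℤ} (c : ℤ) (hn : 0 < n) (h : (c - 1) * n < t * n)
    (h' : t * n < (c + 1) * n) : t = c := by
  have hlo := lt_of_mul_lt_mul_right h hn.le
  have hhi := lt_of_mul_lt_mul_right h' hn.le
  omega

theorem InOrbit.exists_translate (h : InOrbit n u v a b) (hn : 0 < n)
    (huv : u < v ∧ v < u + 4 * n) (hab : a < b ∧ b < a + 4 * n) :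
    ∃ t, (a = u + t * n ∧ b = v + t * n) ∨ (a = v + t * n ∧ b = u + 4 * n + t * n) := by
  obtain ⟨j, k, ⟨rfl, rfl⟩ | ⟨rfl, rfl⟩⟩ := h
  · obtain rfl := eq_of_mul_lt_mul (n := 4 * n) (t := k) 0 (by omega) (by omega) (by omega)
    exact ⟨j, Or.inl ⟨rfl, by ring⟩⟩
  · obtain rfl := eq_of_mul_lt_mul (n := 4 * n) (t := k) 1 (by omega) (by omega) (by omega)
    exact ⟨j, Or.inr ⟨rfl, by ring⟩⟩

theorem Blocked.of_inOrbit (h : Blocked (4 * n) P a b) (hP : PeriodicRel (4 * n) n P)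
    (ho : InOrbit n u v a b) (hn : 0 < n) (huv : u < v ∧ v < u + 4 * n)
    (hab : a < b ∧ b < a + 4 * n) : Blocked (4 * n) P u v := by
  obtain ⟨t, ⟨rfl, rfl⟩ | ⟨rfl, rfl⟩⟩ := ho.exists_translate hn huv hab
  · convert h.rot hP (-t) using 1 <;> ring
  · convert (h.turn hP.toCyclicRel).rot hP (-t - 4) using 1 <;> ring

end Orbits

section AddingOrbits

variable {n u v a₁ a₂ a₃ b₁ b₂ b₃ : ℤ} {P R : ℤ → ℤ → Prop}

/-- Two crossing copies of `[u, v]` differ by a quarter turn. Up to rotation, they are the edge and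
its quarter turn, or the edge `[v, u + 4n]` and its quarter turn, in one of the two orders. -/
theorem exists_mem_of_crossing_copies (hR : PeriodicRel (4 * n) n R) (hn : 0 < n) (huv : u < v)
    (hvu : v ≤ u + 2 * n)
    (ho : a₁ < a₂ ∧ a₂ < a₃ ∧ a₃ < b₁ ∧ b₁ < b₂ ∧ b₂ < b₃ ∧ b₃ < a₁ + 4 * n)
    (h₁ : InOrbit n u v a₁ b₁) (h₂ : InOrbit n u v a₂ b₂) (h₃ : R a₃ b₃) :
    u + n < v ∧ ∃ x y, R x y ∧ ((u < x ∧ x < u + n ∧ v < y ∧ y < v + n) ∨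
      (u + n < x ∧ x < v ∧ v + n < y ∧ y < u + 4 * n)) := by
  obtain ⟨t, h₁⟩ := h₁.exists_translate hn ⟨huv, by omega⟩ ⟨by omega, by omega⟩
  obtain ⟨s, h₂⟩ := h₂.exists_translate hn ⟨huv, by omega⟩ ⟨by omega, by omega⟩
  obtain ⟨d, rfl⟩ : ∃ d, s = t + d := ⟨s - t, by ring⟩
  rw [add_mul] at h₂
  rcases h₁ with h₁ | h₁ <;> rcases h₂ with h₂ | h₂
  · obtain rfl := eq_of_mul_lt_mul (t := d) 1 hn (by omega) (by omega)
    exact ⟨by omega, a₃ - t * n, b₃ - t * n, hR.move h₃ (-t) 0 (by ring) (by ring),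
      Or.inr (by omega)⟩
  · obtain rfl := eq_of_mul_lt_mul (t := d) (-1) hn (by omega) (by omega)
    exact ⟨by omega, b₃ - t * n - 3 * n, a₃ - t * n + n,
      hR.move_symm h₃ (-t - 3) 1 (by ring) (by ring), Or.inl (by omega)⟩
  · obtain rfl := eq_of_mul_lt_mul (t := d) 3 hn (by omega) (by omega)
    exact ⟨by omega, a₃ - t * n - 3 * n, b₃ - t * n - 3 * n,
      hR.move h₃ (-t - 3) 0 (by ring) (by ring), Or.inl (by omega)⟩
  · obtain rfl := eq_of_mul_lt_mul (t := d) 1 hn (by omega) (by omega)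
    exact ⟨by omega, b₃ - t * n - 4 * n, a₃ - t * n,
      hR.move_symm h₃ (-t - 4) 1 (by ring) (by ring), Or.inr (by omega)⟩

theorem not_crossing_copies (hn : 0 < n) (huv : u < v) (hvu : v ≤ u + 2 * n)
    (ho : a₁ < a₂ ∧ a₂ < a₃ ∧ a₃ < b₁ ∧ b₁ < b₂ ∧ b₂ < b₃ ∧ b₃ < a₁ + 4 * n)
    (h₁ : InOrbit n u v a₁ b₁) (h₂ : InOrbit n u v a₂ b₂) : ¬ InOrbit n u v a₃ b₃ := fun h₃ => by
  obtain ⟨hd, x, y, hxy, hpos⟩ :=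
    exists_mem_of_crossing_copies (InOrbit.periodicRel n u v) hn huv hvu ho h₁ h₂ h₃
  obtain ⟨t, ht⟩ := hxy.exists_translate hn ⟨huv, by omega⟩ ⟨by omega, by omega⟩
  rcases hpos with hpos | hpos <;> rcases ht with ht | ht
  · obtain rfl := eq_of_mul_lt_mul (t := t) 0 hn (by omega) (by omega)
    omega
  · obtain rfl := eq_of_mul_lt_mul (t := t) (-1) hn (by omega) (by omega)
    omega
  · obtain rfl := eq_of_mul_lt_mul (t := t) 1 hn (by omega) (by omega)
    omega
  · obtain rfl := eq_of_mul_lt_mul (t := t) 0 hn (by omega) (by omega)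
    omega

/-- If `[u, v]` can be added to `P` but its orbit cannot, then some edge of `P` of length at most
`n` crosses `[u, v]` and its quarter turn: a longer one would block `[u, v]` together with one of
its own quarter turns. -/
theorem exists_short_of_not_isFree (hP : PeriodicRel (4 * n) n P) (hF : IsFree (4 * n) P)
    (hn : 0 < n) (huv : u < v) (hvu : v ≤ u + 2 * n) (hb : ¬ Blocked (4 * n) P u v)
    (hnf : ¬ IsFree (4 * n) (fun x y => P x y ∨ InOrbit n u v x y)) :
    u + n < v ∧ ∃ x y, P x y ∧ (u < x ∧ x < u + n ∧ v < y ∧ y < v + n) ∧ y ≤ x + n := by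
  by_contra! hcon
  refine hnf (hF.or hP.toCyclicRel (InOrbit.periodicRel n u v).toCyclicRel
    (fun a b hab hba ho hc => hb (hc.of_inOrbit hP ho hn ⟨huv, by omega⟩ ⟨hab, hba⟩)) ?_)
  rintro a₁ a₂ a₃ b₁ b₂ b₃ ho h₁ h₂ (h₃ | h₃)
  · obtain ⟨hd, x, y, hxy, hpos⟩ := exists_mem_of_crossing_copies hP hn huv hvu ho h₁ h₂ h₃
    rcases hpos with hpos | hpos
    · have hlong := hcon hd x y hxy hpos
      exact hb ⟨x, y - n, y, x + 3 * n, by omega, hxy,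
        hP.move_symm hxy (-1) 1 (by ring) (by ring)⟩
    · exact hb ⟨x - n, x, y - n, y, by omega, hP.move hxy (-1) 0 (by ring) (by ring), hxy⟩
  · exact not_crossing_copies hn huv hvu ho h₁ h₂ h₃

theorem isFree_or_quarter (hP : PeriodicRel (4 * n) n P) (hF : IsFree (4 * n) P) (hn : 0 < n)
    (hb : ¬ Blocked (4 * n) P u (u + n)) :
    IsFree (4 * n) (fun x y => P x y ∨ InOrbit n u (u + n) x y) := by
  by_contra hnf
  exact (exists_short_of_not_isFree hP hF hn (by omega) (by omega) hb hnf).1.false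

theorem quarter_not_mem {x y : ℤ} (hP : PeriodicRel (4 * n) n P) (hb : ¬ Blocked (4 * n) P u v)
    (huv : u + n < v) (hxy : P x y)
    (hpos : u < x ∧ x < u + n ∧ v < y ∧ y < v + n) (hyx : y ≤ x + n) : ¬ P u (u + n) := fun hq =>
  hb ⟨x, u + n, y, u + 2 * n, by omega, hxy, hP.move hq 1 0 (by ring) (by ring)⟩

theorem quarter_not_blocked {x y : ℤ} (hP : PeriodicRel (4 * n) n P)
    (hb : ¬ Blocked (4 * n) P u v) (huv : u + n < v) (hxy : P x y)
    (hpos : u < x ∧ x < u + n ∧ v < y ∧ y < v + n) (hyx : y ≤ x + n) :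
    ¬ Blocked (4 * n) P u (u + n) := by
  intro hc
  obtain ⟨a, a', b, b', ho, hab, hab'⟩ := hc.rot hP 1
  have hb₁ : ¬ Blocked (4 * n) P (u + n) (v + n) := fun hc => hb (by
    convert hc.rot hP (-1) using 1 <;> ring)
  have hb₂ : ¬ Blocked (4 * n) P (u + 2 * n) (v + 2 * n) := fun hc => hb (by
    convert hc.rot hP (-2) using 1 <;> ring)
  have hxy₁ : P (x + n) (y + n) := hP.rot.2 hxy
  have hb' : v + 2 * n ≤ b' := by
    by_contra
    exact hb₂ ⟨b, b', a + 4 * n, a' + 4 * n, by omega, hP.turn hab, hP.turn hab'⟩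
  have hbv : b ≤ v + n := by
    by_contra
    exact hb₁ ⟨a, a', b, b', by omega, hab, hab'⟩
  have hxa : x + n ≤ a := by
    by_contra
    exact hb₂ ⟨b, y + n, a + 4 * n, x + n + 4 * n, by omega, hP.turn hab, hP.turn hxy₁⟩
  exact hb₁ ⟨x + n, a', y + n, b', by omega, hxy₁, hab'⟩

theorem isFree_or_inOrbit_of_le (hP : PeriodicRel (4 * n) n P) (hF : IsFree (4 * n) P)
    (hn : 0 < n) (huv : u < v) (hvu : v ≤ u + 2 * n) (hb : ¬ Blocked (4 * n) P u v) :
    IsFree (4 * n) (fun x y => P x y ∨ InOrbit n u v x y) ∨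
    ((u + n < v ∧ v < u + 2 * n) ∧ ¬ P u (u + n) ∧
      IsFree (4 * n) (fun x y => P x y ∨ InOrbit n u (u + n) x y)) := by
  refine or_iff_not_imp_left.2 fun hnf => ?_
  obtain ⟨huv', x, y, hxy, hpos, hyx⟩ := exists_short_of_not_isFree hP hF hn huv hvu hb hnf
  exact ⟨⟨huv', by omega⟩, quarter_not_mem hP hb huv' hxy hpos hyx,
    isFree_or_quarter hP hF hn (quarter_not_blocked hP hb huv' hxy hpos hyx)⟩

/-- When `[u, v]` can be added to `P` but its orbit cannot, one of its endpoints starts a missing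
edge joining two vertices a quarter turn apart, and the orbit of that edge can be added. -/
theorem isFree_or_inOrbit (hP : PeriodicRel (4 * n) n P) (hF : IsFree (4 * n) P) (hn : 0 < n)
    (huv : u < v) (hvu : v < u + 4 * n) (hb : ¬ Blocked (4 * n) P u v) :
    IsFree (4 * n) (fun x y => P x y ∨ InOrbit n u v x y) ∨
    ((u + n < v ∧ v < u + 2 * n) ∧ ¬ P u (u + n) ∧
      IsFree (4 * n) (fun x y => P x y ∨ InOrbit n u (u + n) x y)) ∨
    ((u + 2 * n < v ∧ v < u + 3 * n) ∧ ¬ P v (v + n) ∧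
      IsFree (4 * n) (fun x y => P x y ∨ InOrbit n v (v + n) x y)) := by
  rcases le_or_gt v (u + 2 * n) with hle | hgt
  · exact (isFree_or_inOrbit_of_le hP hF hn huv hle hb).imp_right Or.inl
  · have hb' : ¬ Blocked (4 * n) P v (u + 4 * n) := fun hc => hb (by
      convert (hc.turn hP.toCyclicRel).rot hP (-4) using 1 <;> ring)
    refine (isFree_or_inOrbit_of_le hP hF hn hvu (by omega) hb').imp (fun hf => ?_) fun hf => ?_
    · rwa [inOrbit_turn] at hf
    · exact Or.inr ⟨by omega, hf.2⟩

end AddingOrbits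

section Exchange

/-- An `n`-periodic `2`-triangulation of the `4n`-gon, on integer labels. -/
structure PeriodicTwoTri (n : ℤ) (P : ℤ → ℤ → Prop) : Prop
    extends TwoTri (4 * n) P, PeriodicRel (4 * n) n P where
  pos : 0 < n

/-- The set of edges obtained from `P` by exchanging the orbit of `[p, r]` for that of `[x, y]`. -/
def exchange (n : ℤ) (P : ℤ → ℤ → Prop) (p r x y u v : ℤ) : Prop :=
  (P u v ∧ ¬ InOrbit n p r u v) ∨ InOrbit n x y u v

/-- The orbit of the edge `[x, y]`, which is not in `P`, can be exchanged for that of `[p, r]`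
without creating a `3`-crossing. -/
structure IsExchange (n : ℤ) (P : ℤ → ℤ → Prop) (p r x y : ℤ) : Prop where
  lt : x < y ∧ y < x + 4 * n
  notMem : ¬ P x y
  free : IsFree (4 * n) (exchange n P p r x y)

/-- The edge `[x, y]` is, up to rotation by multiples of `n`, a bisector of the angle at `m₁` or
`m₂` of the star `p, l, r, m₁, m₂`. These are the angles whose bisectors form a `3`-crossing with
`[p, r]` and another edge of the star. -/
def Bisects (n p l r m₁ m₂ x y : ℤ) : Prop :=
  ∃ t, (x + 4 * n = m₂ + t * n ∧ l + t * n < y ∧ y < r + t * n) ∨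
    (x + 4 * n = m₁ + t * n ∧ p + t * n < y ∧ y < l + t * n)

variable {n p a b l r m₁ m₂ w x y x' y' : ℤ} {P : ℤ → ℤ → Prop}

theorem exchange_turn (n : ℤ) (P : ℤ → ℤ → Prop) (p r x y : ℤ) :
    exchange n P r (p + 4 * n) x y = exchange n P p r x y := by
  funext u v
  simp only [exchange, inOrbit_turn]

theorem PeriodicRel.exchange (hP : PeriodicRel (4 * n) n P) (p r x y : ℤ) :
    PeriodicRel (4 * n) n (exchange n P p r x y) :=
  (hP.and_not (InOrbit.periodicRel n p r)).or (InOrbit.periodicRel n x y)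

theorem mirrorImage_exchange (n : ℤ) (P : ℤ → ℤ → Prop) (p r x y : ℤ) :
    mirrorImage (exchange n P p r x y) = exchange n (mirrorImage P) (-r) (-p) (-y) (-x) := by
  funext u v
  simp only [mirrorImage_apply, exchange, ← mirrorImage_inOrbit]

theorem PeriodicTwoTri.reflect (h : PeriodicTwoTri n P) : PeriodicTwoTri n (mirrorImage P) where
  toTwoTri := h.toTwoTri.reflect
  rot {u v} := by
    rw [mirrorImage_apply, mirrorImage_apply, ← h.rot (u := -(u + n)), neg_add,
      neg_add_cancel_right, neg_add, neg_add_cancel_right]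
  pos := h.pos

namespace IsExchange

theorem of_inOrbit (e : IsExchange n P p r x y) (hP : PeriodicRel (4 * n) n P)
    (ho : InOrbit n x y x' y') (hlt : x' < y' ∧ y' < x' + 4 * n) : IsExchange n P p r x' y' where
  lt := hlt
  notMem := fun hc => e.notMem (ho.symm.of_periodicRel hP hc)
  free := by
    have hf := e.free
    unfold exchange at hf ⊢
    rwa [ho.eq]

theorem turn (e : IsExchange n P p r x y) (hP : PeriodicRel (4 * n) n P) :
    IsExchange n P p r y (x + 4 * n) := by
  have hlt := e.lt
  exact e.of_inOrbit hP ((InOrbit.periodicRel n x y).turn (InOrbit.refl n x y)) (by omega)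

theorem turn_removed (e : IsExchange n P p r x y) : IsExchange n P r (p + 4 * n) x y where
  lt := e.lt
  notMem := e.notMem
  free := by
    rw [exchange_turn]
    exact e.free

theorem reflect (e : IsExchange n P p r x y) (hP : PeriodicRel (4 * n) n P) :
    IsExchange n (mirrorImage P) (-r) (-p) (-y) (-x) where
  lt := by
    have hlt := e.lt
    omega
  notMem := fun hc => e.notMem (hP.symm (by simpa [mirrorImage_apply] using hc))
  free := by
    rw [← mirrorImage_exchange]
    exact e.free.reflect (hP.exchange p r x y).toCyclicRel

/-- The star at the angle bisected by `[x, y]` forms a `3`-crossing with `[x, y]`, so it has lost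
an edge. -/
theorem exists_star (e : IsExchange n P p r x y) (hP : PeriodicTwoTri n P) :
    ∃ s c u d, TwoStar (4 * n) P x s c u d ∧ c < y ∧ y < u ∧
      (InOrbit n p r s u ∨ InOrbit n p r c d) := by
  have hlt := e.lt
  have hlong : x + 2 < y ∧ y + 2 < x + 4 * n := by
    by_contra
    exact e.notMem (hP.mem_of_short hlt.1 hlt.2 (by omega))
  obtain ⟨s, c, u, d, hst, hc, hu⟩ :=
    hP.toTwoTri.exists_star (v := x) (j := y) (by omega) (by omega)
  have hcy : c < y := by
    refine lt_of_le_of_ne hc ?_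
    rintro rfl
    exact e.notMem hst.mem₀₂
  refine ⟨s, c, u, d, hst, hcy, hu, ?_⟩
  by_contra! hcon
  have hlts := hst.lt
  exact e.free (by omega) (Or.inr (InOrbit.refl n x y)) (Or.inl ⟨hst.mem₁₃, hcon.1⟩)
    (Or.inl ⟨hst.mem₂₄, hcon.2⟩)

end IsExchange

theorem TwoStar.bisects {s c u d t : ℤ} (h : TwoStar (4 * n) P p l r m₁ m₂)
    (hst : TwoStar (4 * n) P x s c u d) (hP : PeriodicTwoTri n P) (hc : c < y) (hu : y < u)
    (ht : s = p + t * n ∧ u = r + t * n ∨ c = p + t * n ∧ d = r + t * n) :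
    Bisects n p l r m₁ m₂ x y := by
  have hlt := h.lt
  have hlts := hst.lt
  have htr := h.translate hP.toPeriodicRel t
  rcases ht with ⟨rfl, he⟩ | ⟨rfl, he⟩
  · have hun := (hst.rotate hP.toCyclicRel).unique htr hP.free (j := r + t * n) (by omega)
      (by omega)
    exact ⟨t, Or.inl (by omega)⟩
  · have hun := (hst.rotate₂ hP.toCyclicRel).unique htr hP.free (j := r + t * n) (by omega)
      (by omega)
    exact ⟨t, Or.inr (by omega)⟩

/-- The two stars `p, l, r, m₁, m₂` and `p, a, b, r, w` at the edge `[p, r]`, in the case where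
their common bisector is `[a, m₁]`. -/
structure StarPair (n : ℤ) (P : ℤ → ℤ → Prop) (p a b l r m₁ m₂ w : ℤ) : Prop where
  left : TwoStar (4 * n) P p l r m₁ m₂
  right : TwoStar (4 * n) P p a b r w
  le_left : b ≤ l
  le_right : m₂ ≤ w

theorem TwoStar.pair_cases (hL : TwoStar (4 * n) P p l r m₁ m₂) (hM : TwoStar (4 * n) P p a b r w)
    (hP : TwoTri (4 * n) P) : (b ≤ l ∧ m₂ ≤ w) ∨ (l ≤ a ∧ w ≤ m₁) := by
  have hltL := hL.lt
  have hltM := hM.lt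
  have hF := hP.free
  rcases lt_trichotomy l a with hla | rfl | hal
  · by_contra
    exact hF (by omega) hM.mem₀₂ hL.mem₁₃ hM.mem₁₄
  · by_contra
    exact (hM.rotate hP.toCyclicRel).not_bisected hF (by omega) (by omega) hL.mem₁₃
  · rcases lt_trichotomy w m₁ with hwm | rfl | hmw
    · exact (hF (by omega) hL.mem₂₄ (hP.turn hM.mem₁₄) (hP.turn hL.mem₁₃)).elim
    · exact ((hL.rotate₃ hP.toCyclicRel).not_bisected hF (by omega) (by omega)
        (hP.turn hM.mem₁₄)).elim
    · left
      by_contra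
      rcases lt_or_ge l b with hlb | hbl
      · exact hF (by omega) hM.mem₁₃ hL.mem₁₃ hM.mem₂₄
      · exact hF (by omega) hL.mem₀₃ hM.mem₁₄ hL.mem₁₄

namespace StarPair

theorem swap (h : StarPair n P p a b l r m₁ m₂ w) (hP : CyclicRel (4 * n) P) :
    StarPair n P r m₁ m₂ w (p + 4 * n) (a + 4 * n) (b + 4 * n) (l + 4 * n) where
  left := h.right.rotate₃ hP
  right := h.left.rotate₂ hP
  le_left := h.le_right
  le_right := by linarith [h.le_left]

theorem lt (h : StarPair n P p a b l r m₁ m₂ w) : p < a ∧ a < b ∧ b ≤ l ∧ l < r ∧ r < m₁ ∧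
    m₁ < m₂ ∧ m₂ ≤ w ∧ w < p + 4 * n := by
  have hleft := h.left.lt
  have hright := h.right.lt
  have hbl := h.le_left
  have hmw := h.le_right
  omega

theorem bisector_not_mem (h : StarPair n P p a b l r m₁ m₂ w) (hF : IsFree (4 * n) P) :
    ¬ P a m₁ := fun hc => by
  have hlt := h.lt
  exact hF (by omega) h.left.mem₀₂ hc h.left.mem₁₄

/-- The common bisector is blocked only by pairs containing the common edge. -/
theorem eq_of_blocking (h : StarPair n P p a b l r m₁ m₂ w) (hP : TwoTri (4 * n) P)
    {c c' d d' : ℤ} (ho : a < c ∧ c < c' ∧ c' < m₁ ∧ m₁ < d ∧ d < d' ∧ d' < a + 4 * n)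
    (hcd : P c d) (hcd' : P c' d') : c' = r ∧ d' = p + 4 * n := by
  have hlt := h.lt
  have hF := hP.free
  have hrc' : r ≤ c' := by
    by_contra
    exact hF (by omega) h.right.mem₁₃ hcd hcd'
  have hdw : d ≤ w := by
    by_contra
    exact hF (by omega) h.right.mem₁₄ hcd hcd'
  have hpd' : p + 4 * n ≤ d' := by
    by_contra
    exact hF (by omega) h.left.mem₀₃ hcd hcd'
  have hcl : c ≤ l := by
    by_contra
    exact hF (by omega) h.left.mem₁₃ hcd hcd'
  have hor : ¬ (r < c' ∧ p + 4 * n < d') := by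
    rintro ⟨hrc, hpd⟩
    exact hF (by omega) hcd (hP.turn h.left.mem₀₂) hcd'
  rcases eq_or_lt_of_le hrc' with rfl | hrc
  · refine ⟨rfl, ?_⟩
    by_contra
    exact (h.right.rotate₃ hP.toCyclicRel).not_bisected hF (by omega) (by omega) hcd'
  · obtain rfl : d' = p + 4 * n := by omega
    exact (h.left.not_bisected hF hrc (by omega) (hP.symm (hP.add_right.1 hcd'))).elim

theorem not_inOrbit_right₁₃ (h : StarPair n P p a b l r m₁ m₂ w) (hP : PeriodicTwoTri n P) :
    ¬ InOrbit n p r a r := fun ho => by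
  have hn := hP.pos
  have hlt := h.lt
  obtain ⟨t, ht | ht⟩ := ho.exists_translate hn (by omega) (by omega)
  · omega
  · obtain rfl := eq_of_mul_lt_mul (t := t) (-1) hn (by omega) (by omega)
    exact (h.right.rotate₃ hP.toCyclicRel).not_bisected hP.free (y := w + n) (by omega) (by omega)
      (hP.move h.right.mem₁₄ 1 0 (by omega) (by omega))

theorem not_inOrbit_right₀₂ (h : StarPair n P p a b l r m₁ m₂ w) (hP : PeriodicTwoTri n P) :
    ¬ InOrbit n p r p b := fun ho => by
  have hn := hP.pos
  have hlt := h.lt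
  obtain ⟨t, ht | ht⟩ := ho.exists_translate hn (by omega) (by omega)
  · omega
  · obtain rfl := eq_of_mul_lt_mul (t := t) (-3) hn (by omega) (by omega)
    exact h.right.not_bisected hP.free (y := w - n) (by omega) (by omega)
      (hP.move h.right.mem₂₄ (-1) 0 (by omega) (by omega))

theorem not_inOrbit_quarter (h : StarPair n P p a b l r m₁ m₂ w) (hP : PeriodicTwoTri n P)
    (hm : m₁ < a + 2 * n) : ¬ InOrbit n p r a (a + n) := fun ho => by
  have hn := hP.pos
  have hlt := h.lt
  obtain ⟨t, ht | ht⟩ := ho.exists_translate hn (by omega) (by omega)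
  · obtain rfl := eq_of_mul_lt_mul (t := t) 1 hn (by omega) (by omega)
    omega
  · obtain rfl := eq_of_mul_lt_mul (t := t) (-1) hn (by omega) (by omega)
    exact (h.right.rotate₃ hP.toCyclicRel).not_bisected hP.free (y := w + n) (by omega) (by omega)
      (hP.move h.right.mem₁₄ 1 0 (by omega) (by omega))

theorem exists_isExchange (h : StarPair n P p a b l r m₁ m₂ w) (hP : PeriodicTwoTri n P) :
    ∃ x y, IsExchange n P p r x y := by
  have hn := hP.pos
  have hlt := h.lt
  have hQ := hP.and_not (InOrbit.periodicRel n p r)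
  have hb : ¬ Blocked (4 * n) (fun u v => P u v ∧ ¬ InOrbit n p r u v) a m₁ := by
    rintro ⟨c, c', d, d', ho, hcd, hcd'⟩
    obtain ⟨rfl, rfl⟩ := h.eq_of_blocking hP.toTwoTri ho hcd.1 hcd'.1
    exact hcd'.2 ((InOrbit.periodicRel n p c').turn (InOrbit.refl n p c'))
  rcases isFree_or_inOrbit hQ (hP.free.mono fun u v hc => hc.1) hn (by omega) (by omega) hb with
    hf | ⟨hm, hno, hf⟩ | ⟨hm, hno, hf⟩
  · exact ⟨a, m₁, by omega, h.bisector_not_mem hP.free, hf⟩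
  · exact ⟨a, a + n, by omega, fun hc => hno ⟨hc, h.not_inOrbit_quarter hP (by omega)⟩, hf⟩
  · have hq := (h.swap hP.toCyclicRel).not_inOrbit_quarter hP (by omega)
    rw [inOrbit_turn] at hq
    exact ⟨m₁, m₁ + n, by omega, fun hc => hno ⟨hc, hq⟩, hf⟩

theorem bisects (h : StarPair n P p a b l r m₁ m₂ w) (hP : PeriodicTwoTri n P)
    (e : IsExchange n P p r x y) :
    Bisects n p l r m₁ m₂ x y ∨ Bisects n r w (p + 4 * n) (a + 4 * n) (b + 4 * n) x y := by
  have hlt := h.lt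
  have hswap := (h.swap hP.toCyclicRel).left
  obtain ⟨s, c, u, d, hst, hc, hu, ho | ho⟩ := e.exists_star hP <;> have hlts := hst.lt <;>
    obtain ⟨t, ht | ht⟩ := ho.exists_translate hP.pos (by omega) (by omega)
  · exact Or.inl (h.left.bisects hst hP hc hu (Or.inl ht))
  · exact Or.inr (hswap.bisects hst hP hc hu (Or.inl ht))
  · exact Or.inl (h.left.bisects hst hP hc hu (Or.inr ht))
  · exact Or.inr (hswap.bisects hst hP hc hu (Or.inr ht))

theorem false_of_mem_angle₄ (h : StarPair n P p a b l r m₁ m₂ w) (hP : PeriodicTwoTri n P)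
    (e : IsExchange n P p r x m₂) (hx : l < x ∧ x < r) (ho : ¬ InOrbit n p r l m₁) : False := by
  have hlt := h.lt
  exact e.free (by omega) (Or.inl ⟨h.right.mem₁₃, h.not_inOrbit_right₁₃ hP⟩)
    (Or.inl ⟨h.left.mem₁₃, ho⟩) (Or.inr (InOrbit.refl n x m₂))

theorem eq_of_mem_angle₃ (h : StarPair n P p a b l r m₁ m₂ w) (hP : PeriodicTwoTri n P)
    (e : IsExchange n P p r x m₁) (hx : p < x ∧ x < l) (ho : ¬ InOrbit n p r l m₂)
    (ho' : ¬ InOrbit n p r a w) : x = a := by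
  have hlt := h.lt
  by_contra hne
  rcases lt_or_gt_of_ne hne with hxa | hax
  · exact e.free (by omega) (Or.inl ⟨h.right.mem₀₂, h.not_inOrbit_right₀₂ hP⟩)
      (Or.inr (InOrbit.refl n x m₁)) (Or.inl ⟨h.right.mem₁₄, ho'⟩)
  · exact e.free (by omega) (Or.inl ⟨h.right.mem₁₃, h.not_inOrbit_right₁₃ hP⟩)
      (Or.inr (InOrbit.refl n x m₁)) (Or.inl ⟨h.left.mem₁₄, ho⟩)

theorem inOrbit_of_mem_angle₃ (h : StarPair n P p a b l r m₁ m₂ w) (hP : PeriodicTwoTri n P)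
    (e : IsExchange n P p r x y) {t : ℤ} (hx : x + 4 * n = m₁ + t * n)
    (hy : p + t * n < y ∧ y < l + t * n) (ho : ¬ InOrbit n p r l m₂)
    (ho' : ¬ InOrbit n p r a w) : InOrbit n a m₁ x y := by
  have hlt := h.lt
  have hxy : InOrbit n x y (y - t * n) m₁ := ⟨-t, 1, Or.inr ⟨by ring, by linarith⟩⟩
  have hya : y - t * n = a :=
    h.eq_of_mem_angle₃ hP (e.of_inOrbit hP.toPeriodicRel hxy (by omega)) (by omega) ho ho'
  rw [hya] at hxy
  exact hxy.symm

theorem inOrbit_of_bisects (h : StarPair n P p a b l r m₁ m₂ w) (hP : PeriodicTwoTri n P)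
    (e : IsExchange n P p r x y) (hb : Bisects n p l r m₁ m₂ x y) (ho : ¬ InOrbit n p r l m₁)
    (ho' : ¬ InOrbit n p r l m₂) (ho'' : ¬ InOrbit n p r a w) : InOrbit n a m₁ x y := by
  have hlt := h.lt
  obtain ⟨t, ⟨hx, hy⟩ | ⟨hx, hy⟩⟩ := hb
  · have hxy : InOrbit n x y (y - t * n) m₂ := ⟨-t, 1, Or.inr ⟨by ring, by linarith⟩⟩
    exact (h.false_of_mem_angle₄ hP (e.of_inOrbit hP.toPeriodicRel hxy (by omega)) (by omega)
      ho).elim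
  · exact h.inOrbit_of_mem_angle₃ hP e hx hy ho' ho''

/-- In a linked pair of stars the second star is a copy of the first one under rotation by a
multiple of `n`. -/
def Linked (n p a b l r m₁ m₂ w : ℤ) : Prop :=
  l = r - n ∧ m₁ = p + 3 * n ∧ a = m₂ - 3 * n ∧ b = p + n ∧ w = r + n

theorem linked_of_inOrbit₁₃ (h : StarPair n P p a b l r m₁ m₂ w) (hP : PeriodicTwoTri n P)
    (ho : InOrbit n p r l m₁) : Linked n p a b l r m₁ m₂ w := by
  have hn := hP.pos
  have hlt := h.lt
  obtain ⟨t, ht | ht⟩ := ho.exists_translate hn (by omega) (by omega)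
  · obtain rfl := eq_of_mul_lt_mul (t := t) 1 hn (by omega) (by omega)
    have hst := (h.left.translate hP.toPeriodicRel (-1)).rotate hP.toCyclicRel
    rw [show l + -1 * n = p by omega] at hst
    have hun := hst.unique h.left hP.free (j := r) (by omega) (by omega)
    omega
  · obtain rfl := eq_of_mul_lt_mul (t := t) (-1) hn (by omega) (by omega)
    have hst := (h.left.translate hP.toPeriodicRel (-3)).rotate₃ hP.toCyclicRel
    rw [show m₁ + -3 * n = p by omega] at hst
    have hun := hst.unique h.right hP.free (j := r - 1) (by omega) (by omega)
    exact ⟨by omega, by omega, by omega, by omega, by omega⟩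

theorem linked_swap_of_inOrbit₁₄ (h : StarPair n P p a b l r m₁ m₂ w) (hP : PeriodicTwoTri n P)
    (ho : InOrbit n p r l m₂) :
    Linked n r m₁ m₂ w (p + 4 * n) (a + 4 * n) (b + 4 * n) (l + 4 * n) := by
  have hn := hP.pos
  have hlt := h.lt
  obtain ⟨t, ht | ht⟩ := ho.exists_translate hn (by omega) (by omega)
  · obtain rfl := eq_of_mul_lt_mul (t := t) 1 hn (by omega) (by omega)
    have hst := (h.left.translate hP.toPeriodicRel (-1)).rotate hP.toCyclicRel
    rw [show l + -1 * n = p by omega] at hst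
    have hun := hst.unique h.right hP.free (j := r - 1) (by omega) (by omega)
    exact ⟨by omega, by omega, by omega, by omega, by omega⟩
  · obtain rfl := eq_of_mul_lt_mul (t := t) (-1) hn (by omega) (by omega)
    have hst := (h.left.translate hP.toPeriodicRel (-3)).rotate₄ hP.toCyclicRel
    rw [show m₂ + -3 * n = p by omega] at hst
    have hun := hst.unique h.left hP.free (j := r) (by omega) (by omega)
    omega

theorem Linked.unswap
    (hk : Linked n (p + 4 * n) (a + 4 * n) (b + 4 * n) (l + 4 * n) (r + 4 * n) (m₁ + 4 * n)
      (m₂ + 4 * n) (w + 4 * n)) : Linked n p a b l r m₁ m₂ w := by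
  obtain ⟨hl, hm, ha, hb, hw⟩ := hk
  exact ⟨by omega, by omega, by omega, by omega, by omega⟩

theorem not_inOrbit_left₁₄_of_linked (h : StarPair n P p a b l r m₁ m₂ w)
    (hP : PeriodicTwoTri n P) (hk : Linked n p a b l r m₁ m₂ w) : ¬ InOrbit n p r l m₂ := by
  obtain ⟨hl, -, ha, -, -⟩ := hk
  exact fun ho => h.not_inOrbit_right₁₃ hP
    ((InOrbit.periodicRel n p r).move_symm ho (-3) 1 (by omega) (by omega))

theorem not_inOrbit_right₁₄_of_linked (h : StarPair n P p a b l r m₁ m₂ w) (hn : 0 < n)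
    (hk : Linked n p a b l r m₁ m₂ w) : ¬ InOrbit n p r a w := fun ho => by
  have hlt := h.lt
  obtain ⟨-, hm, ha, hb, hw⟩ := hk
  obtain ⟨t, ht | ht⟩ := ho.exists_translate hn (by omega) (by omega)
  · obtain rfl := eq_of_mul_lt_mul (t := t) 1 hn (by omega) (by omega)
    omega
  · obtain rfl := eq_of_mul_lt_mul (t := t) (-1) hn (by omega) (by omega)
    omega

theorem le_of_linked (h : StarPair n P p a b l r m₁ m₂ w) (hP : PeriodicTwoTri n P)
    (hk : Linked n p a b l r m₁ m₂ w) : a + 2 * n ≤ r := by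
  by_contra
  have hlt := h.lt
  obtain ⟨hl, -, ha, -, hw⟩ := hk
  have hcopy : P (r - 2 * n) (a + n) := hP.move h.left.mem₂₄ (-2) 0 (by omega) (by omega)
  have hcopy' : P (r - n) (a + 2 * n) := hP.move hcopy 1 0 (by ring) (by ring)
  exact hP.free (by omega) hcopy h.right.mem₁₃ hcopy'

theorem endpoint_of_linked (h : StarPair n P p a b l r m₁ m₂ w) (hP : PeriodicTwoTri n P)
    (hk : Linked n p a b l r m₁ m₂ w) (e : IsExchange n P p r x y) :
    ∃ k, x = p + k * n ∨ x = a + k * n := by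
  obtain ⟨-, hm, ha, hb, -⟩ := hk
  rcases h.bisects hP e with ⟨t, ⟨hx, -⟩ | ⟨hx, -⟩⟩ | ⟨t, ⟨hx, -⟩ | ⟨hx, -⟩⟩
  · exact ⟨t - 1, Or.inr (by linarith)⟩
  · exact ⟨t - 1, Or.inl (by linarith)⟩
  · exact ⟨t + 1, Or.inl (by linarith)⟩
  · exact ⟨t, Or.inr (by linarith)⟩

theorem eq_of_linked (h : StarPair n P p a b l r m₁ m₂ w) (hP : PeriodicTwoTri n P)
    (hk : Linked n p a b l r m₁ m₂ w) (e : IsExchange n P p r a y) (hy : r < y ∧ y < r + n) :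
    y = m₁ := by
  have hn := hP.pos
  have hlt := h.lt
  have har := h.le_of_linked hP hk
  have hex := hP.toPeriodicRel.exchange p r a y
  obtain ⟨k, hyk⟩ := h.endpoint_of_linked hP hk (e.turn hP.toPeriodicRel)
  obtain ⟨-, hm, -, hb, -⟩ := hk
  rcases hyk with rfl | rfl
  · obtain rfl := eq_of_mul_lt_mul (t := k) 3 hn (by omega) (by omega)
    omega
  · obtain rfl := eq_of_mul_lt_mul (t := k) 3 hn (by omega) (by omega)
    have h₁₃ : exchange n P p r a (a + 3 * n) a r :=
      Or.inl ⟨h.right.mem₁₃, h.not_inOrbit_right₁₃ hP⟩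
    have h₀₂ : exchange n P p r a (a + 3 * n) p b :=
      Or.inl ⟨h.right.mem₀₂, h.not_inOrbit_right₀₂ hP⟩
    have hnew : exchange n P p r a (a + 3 * n) a (a + 3 * n) := Or.inr (InOrbit.refl n _ _)
    exact (e.free (by omega) h₁₃ (hex.move h₀₂ 2 0 rfl rfl)
      (hex.move_symm hnew (-1) 1 rfl rfl)).elim

theorem inOrbit_of_linked (h : StarPair n P p a b l r m₁ m₂ w) (hP : PeriodicTwoTri n P)
    (hk : Linked n p a b l r m₁ m₂ w) (e : IsExchange n P p r x y) : InOrbit n a m₁ x y := by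
  have hlt := h.lt
  have hw := hk.2.2.2.2
  have of_start : ∀ t, x = a + t * n → r + t * n < y ∧ y < r + n + t * n →
      InOrbit n a m₁ x y := fun t hx hy => by
    have hxy : InOrbit n x y a (y - t * n) := ⟨-t, 0, Or.inl ⟨by linarith, by ring⟩⟩
    have hym : y - t * n = m₁ :=
      h.eq_of_linked hP hk (e.of_inOrbit hP.toPeriodicRel hxy (by omega)) (by omega)
    rw [hym] at hxy
    exact hxy.symm
  have hright := h.not_inOrbit_right₁₄_of_linked hP.pos hk
  have hleft := h.not_inOrbit_left₁₄_of_linked hP hk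
  obtain ⟨hl, -, ha, hb, -⟩ := hk
  rcases h.bisects hP e with ⟨t, ⟨hx, hy⟩ | ⟨hx, hy⟩⟩ | ⟨t, ⟨hx, hy⟩ | ⟨hx, hy⟩⟩
  · exact of_start (t - 1) (by linarith) (by rw [sub_one_mul]; omega)
  · exact h.inOrbit_of_mem_angle₃ hP e hx hy hleft hright
  · have hxy : InOrbit n x y (y - t * n) (b + 4 * n) := ⟨-t, 1, Or.inr ⟨by ring, by linarith⟩⟩
    refine ((h.swap hP.toCyclicRel).false_of_mem_angle₄ hP
      (e.of_inOrbit hP.toPeriodicRel hxy (by omega)).turn_removed (by omega) ?_).elim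
    rw [inOrbit_turn]
    exact fun ho => hright ((InOrbit.periodicRel n p r).symm
      ((InOrbit.periodicRel n p r).add_right.1 ho))
  · exact of_start t (by linarith) (by omega)

/-- Only copies of the common bisector can be exchanged for the common edge. -/
theorem inOrbit_of_isExchange (h : StarPair n P p a b l r m₁ m₂ w) (hP : PeriodicTwoTri n P)
    (e : IsExchange n P p r x y) : InOrbit n a m₁ x y := by
  have hO := InOrbit.periodicRel n p r
  have hsw := h.swap hP.toCyclicRel
  have linked_swap : Linked n r m₁ m₂ w (p + 4 * n) (a + 4 * n) (b + 4 * n) (l + 4 * n) →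
      InOrbit n a m₁ x y := fun hk => by
    simpa only [inOrbit_turn] using hsw.inOrbit_of_linked hP hk e.turn_removed
  by_cases ho₁ : InOrbit n p r l m₁
  · exact h.inOrbit_of_linked hP (h.linked_of_inOrbit₁₃ hP ho₁) e
  by_cases ho₂ : InOrbit n p r l m₂
  · exact linked_swap (h.linked_swap_of_inOrbit₁₄ hP ho₂)
  by_cases ho₃ : InOrbit n p r a w
  · exact linked_swap (hsw.linked_of_inOrbit₁₃ hP (by rw [inOrbit_turn]; exact hO.turn ho₃))
  by_cases ho₄ : InOrbit n p r b w
  · exact h.inOrbit_of_linked hP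
      (hsw.linked_swap_of_inOrbit₁₄ hP (by rw [inOrbit_turn]; exact hO.turn ho₄)).unswap e
  rcases h.bisects hP e with hb | hb
  · exact h.inOrbit_of_bisects hP e hb ho₁ ho₂ ho₃
  · have hxy := hsw.inOrbit_of_bisects hP e.turn_removed hb
    simp only [inOrbit_turn, hO.add_right] at hxy
    exact hxy (mt hO.symm ho₃) (mt hO.symm ho₄) (mt hO.symm ho₁)

theorem exists_unique_isExchange (h : StarPair n P p a b l r m₁ m₂ w) (hP : PeriodicTwoTri n P) :
    ∃ x y, IsExchange n P p r x y ∧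
      ∀ x' y', IsExchange n P p r x' y' → InOrbit n x y x' y' := by
  obtain ⟨x, y, e⟩ := h.exists_isExchange hP
  exact ⟨x, y, e, fun x' y' e' =>
    (h.inOrbit_of_isExchange hP e).symm.trans (h.inOrbit_of_isExchange hP e')⟩

end StarPair

theorem PeriodicTwoTri.exists_unique_isExchange (hP : PeriodicTwoTri n P) (hpr : p + 3 ≤ r)
    (hrp : r ≤ p + 4 * n - 3) (hmem : P p r) :
    ∃ x y, IsExchange n P p r x y ∧
      ∀ x' y', IsExchange n P p r x' y' → InOrbit n x y x' y' := by
  have hC := hP.toCyclicRel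
  obtain ⟨l, m₁, m₂, hL⟩ := hP.exists_star_mem₀₂ (by omega) hrp hmem
  obtain ⟨a, b, w, hM⟩ := hP.exists_star_mem₀₃ hpr (by omega) hmem
  rcases hL.pair_cases hM hP.toTwoTri with ⟨hbl, hmw⟩ | ⟨hla, hwm⟩
  · exact StarPair.exists_unique_isExchange ⟨hL, hM, hbl, hmw⟩ hP
  · have hpair : StarPair n (mirrorImage P) (-r) (-b) (-a) (-l) (-p) (4 * n - m₂) (4 * n - m₁)
        (4 * n - w) := by
      refine ⟨?_, ?_, by omega, by omega⟩
      · simpa using (hL.rotate₂ hC).reflect hC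
      · simpa using (hM.rotate₃ hC).reflect hC
    obtain ⟨x, y, e, huniq⟩ := hpair.exists_unique_isExchange hP.reflect
    refine ⟨-y, -x, by simpa using e.reflect hP.reflect.toPeriodicRel, fun x' y' e' => ?_⟩
    have hrefl := huniq _ _ (e'.reflect hP.toPeriodicRel)
    rw [← mirrorImage_inOrbit, mirrorImage_apply]
    exact (InOrbit.periodicRel n _ _).symm hrefl

end Exchange

section Crossings

variable {V : Type*} [CircularOrder V] {e f : Edge V} {T : Set (Edge V)}

theorem Edge.Crosses.symm (h : e.Crosses f) : f.Crosses e := by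
  obtain ⟨a, b, c, d, he, hf, hacb, hbda⟩ := h
  exact ⟨c, d, b, a, hf, by rw [he, Sym2.eq_swap], (hbda.cyclic_left.trans_left hacb).cyclic_left,
    (hacb.cyclic_left.trans_left hbda).cyclic_left⟩

theorem Edge.Crosses.ne (h : e.Crosses f) : e ≠ f := by
  rintro rfl
  obtain ⟨a, b, c, d, he, hf, hacb, -⟩ := h
  rw [he, Sym2.eq_iff] at hf
  rcases hf with ⟨rfl, rfl⟩ | ⟨rfl, rfl⟩
  · exact sbtw_irrefl_left hacb
  · exact sbtw_irrefl_right hacb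

theorem crossingFree_three_iff : CrossingFree 3 T ↔
    ∀ e ∈ T, ∀ f ∈ T, ∀ g ∈ T, e.Crosses f → e.Crosses g → f.Crosses g → False := by
  classical
  constructor
  · intro h e he f hf g hg hef heg hfg
    refine h {e, f, g} ?_ ⟨Finset.card_eq_three.2 ⟨e, f, g, hef.ne, heg.ne, hfg.ne, rfl⟩, ?_⟩
    · simp [Set.insert_subset_iff, he, hf, hg]
    · rw [Finset.coe_insert, Finset.coe_insert, Finset.coe_singleton]
      refine (Set.pairwise_singleton _ _).insert (fun x hx _ => ?_) |>.insert fun x hx _ => ?_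
      · obtain rfl := hx
        exact ⟨hfg, hfg.symm⟩
      · rcases hx with rfl | rfl
        · exact ⟨hef, hef.symm⟩
        · exact ⟨heg, heg.symm⟩
  · rintro h F hF ⟨hcard, hpair⟩
    obtain ⟨e, f, g, hef, heg, hfg, rfl⟩ := Finset.card_eq_three.1 hcard
    simp only [Finset.coe_insert, Finset.coe_singleton, Set.insert_subset_iff,
      Set.singleton_subset_iff] at hF
    exact h e hF.1 f hF.2.1 g hF.2.2 (hpair (by simp) (by simp) hef)
      (hpair (by simp) (by simp) heg) (hpair (by simp) (by simp) hfg)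

theorem CrossingFree.exists_crosses_of_insert (hT : CrossingFree 3 T)
    (he : ¬ CrossingFree 3 (insert e T)) :
    ∃ f ∈ T, ∃ g ∈ T, e.Crosses f ∧ e.Crosses g ∧ f.Crosses g := by
  rw [crossingFree_three_iff] at hT he
  push Not at he
  obtain ⟨x, hx, y, hy, z, hz, hxy, hxz, hyz, -⟩ := he
  rcases hx with rfl | hx
  · exact ⟨y, hy.resolve_left hxy.ne.symm, z, hz.resolve_left hxz.ne.symm, hxy, hxz, hyz⟩
  rcases hy with rfl | hy
  · exact ⟨x, hx, z, hz.resolve_left hyz.ne.symm, hxy.symm, hyz, hxz⟩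
  rcases hz with rfl | hz
  · exact ⟨x, hx, y, hy, hxz.symm, hyz.symm, hxy⟩
  · exact (hT x hx y hy z hz hxy hxz hyz).elim

end Crossings

section Labels

variable {V : Type*} [IntCast V] {e f : Edge V} {T : Set (Edge V)} {u v : ℤ}

/-- The integers `u` and `v` label the endpoints of `e`. For `V = ZMod N` each vertex has many
labels; for `V = ℤ` it is its own label. -/
def Edge.Joins (e : Edge V) (u v : ℤ) : Prop := e.1 = s((u : V), (v : V))

/-- The set of edges `T` as a relation on integer labels. -/
def Joined (T : Set (Edge V)) (u v : ℤ) : Prop := ∃ e ∈ T, e.Joins u v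

theorem Edge.Joins.symm (h : e.Joins u v) : e.Joins v u := h.trans Sym2.eq_swap

theorem Edge.Joins.unique (he : e.Joins u v) (hf : f.Joins u v) : e = f :=
  Subtype.ext (Eq.trans he (Eq.symm hf))

theorem joined_iff_mem (he : e.Joins u v) : Joined T u v ↔ e ∈ T :=
  ⟨fun ⟨_, hf, hfe⟩ => hfe.unique he ▸ hf, fun h => ⟨e, h, he⟩⟩

theorem Joined.mono {T' : Set (Edge V)} (hT : T ⊆ T') (h : Joined T u v) : Joined T' u v :=
  h.imp fun _ he => ⟨hT he.1, he.2⟩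

end Labels

theorem Edge.Joins.shift {V : Type*} [Ring V] {e : Edge V} {u v : ℤ} (h : e.Joins u v) (ℓ : ℤ)
    (n : ℕ) : (e.shift (ℓ • (n : V))).Joins (u + ℓ * n) (v + ℓ * n) := by
  change Sym2.map (· + ℓ • (n : V)) e.1 = _
  rw [h, Sym2.map_mk]
  simp

section IntLabels

variable {T : Set (Edge ℤ)} {e f : Edge ℤ} {a b c d u v : ℤ}

theorem exists_int_edge (huv : u < v) : ∃ e : Edge ℤ, e.Joins u v :=
  ⟨⟨s(u, v), fun h => huv.ne h⟩, rfl⟩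

theorem Edge.exists_joins_int (e : Edge ℤ) : ∃ u v : ℤ, u < v ∧ e.Joins u v := by
  obtain ⟨⟨x, y⟩, he⟩ := e
  rcases lt_or_gt_of_ne (show x ≠ y from he) with h | h
  · exact ⟨x, y, h, rfl⟩
  · exact ⟨y, x, h, Sym2.eq_swap⟩

theorem Edge.Joins.eq_int (h : e.Joins a b) (h' : e.Joins c d) (hab : a < b) (hcd : c < d) :
    a = c ∧ b = d := by
  have hac := Eq.trans (Eq.symm h) h'
  simp only [Int.cast_id, Sym2.eq_iff] at hac
  omega

theorem Edge.Joins.crosses_int (he : e.Joins a b) (hf : f.Joins c d)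
    (h : a < c ∧ c < b ∧ b < d) : e.Crosses f :=
  ⟨a, b, c, d, he, hf, Or.inl ⟨h.1, h.2.1⟩, Or.inr (Or.inr ⟨by omega, h.2.2⟩)⟩

theorem Edge.Crosses.lt_int (h : e.Crosses f) (he : e.Joins a b) (hf : f.Joins c d) (hab : a < b)
    (hcd : c < d) : (a < c ∧ c < b ∧ b < d) ∨ (c < a ∧ a < d ∧ d < b) := by
  obtain ⟨x, y, z, w, he', hf', hxzy, hywx⟩ := h
  have hxy := Eq.trans (Eq.symm he) he'
  have hzw := Eq.trans (Eq.symm hf) hf'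
  simp only [Int.cast_id, Sym2.eq_iff] at hxy hzw
  rw [Int.sbtw_iff] at hxzy hywx
  omega

theorem crossingFree_int_iff : CrossingFree 3 T ↔
    ∀ ⦃a₁ a₂ a₃ b₁ b₂ b₃ : ℤ⦄, a₁ < a₂ ∧ a₂ < a₃ ∧ a₃ < b₁ ∧ b₁ < b₂ ∧ b₂ < b₃ →
      Joined T a₁ b₁ → Joined T a₂ b₂ → Joined T a₃ b₃ → False := by
  rw [crossingFree_three_iff]
  constructor
  · rintro h a₁ a₂ a₃ b₁ b₂ b₃ ho ⟨e, heT, he⟩ ⟨f, hfT, hf⟩ ⟨g, hgT, hg⟩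
    exact h e heT f hfT g hgT (he.crosses_int hf (by omega)) (he.crosses_int hg (by omega))
      (hf.crosses_int hg (by omega))
  · intro h e heT f hfT g hgT hef heg hfg
    obtain ⟨a, b, hab, he⟩ := e.exists_joins_int
    obtain ⟨c, d, hcd, hf⟩ := f.exists_joins_int
    obtain ⟨x, y, hxy, hg⟩ := g.exists_joins_int
    have heJ : Joined T a b := ⟨e, heT, he⟩
    have hfJ : Joined T c d := ⟨f, hfT, hf⟩
    have hgJ : Joined T x y := ⟨g, hgT, hg⟩
    rcases hef.lt_int he hf hab hcd with hac | hca <;>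
      rcases heg.lt_int he hg hab hxy with hax | hxa <;>
      rcases hfg.lt_int hf hg hcd hxy with hcx | hxc
    · exact h (by omega) heJ hfJ hgJ
    · exact h (by omega) heJ hgJ hfJ
    · omega
    · exact h (by omega) hgJ heJ hfJ
    · exact h (by omega) hfJ heJ hgJ
    · omega
    · exact h (by omega) hfJ hgJ heJ
    · exact h (by omega) hgJ hfJ heJ

end IntLabels

section ZModLabels

variable {N : ℕ} {a b c d u v : ℤ} {e f g : Edge (ZMod N)} {T : Set (Edge (ZMod N))}

theorem intCast_eq_iff_exists : (a : ZMod N) = b ↔ ∃ m : ℤ, b = a + m * N := by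
  rw [ZMod.intCast_eq_intCast_iff, Int.modEq_iff_dvd]
  exact exists_congr fun m => by rw [sub_eq_iff_eq_add', mul_comm]

theorem eq_of_intCast_eq (h : (a : ZMod N) = b) (hab : a < b + N) (hba : b < a + N) : a = b := by
  obtain ⟨m, rfl⟩ := intCast_eq_iff_exists.1 h
  obtain rfl := eq_of_mul_lt_mul (n := N) (t := m) 0 (by omega) (by omega) (by omega)
  ring

theorem exists_edge (huv : u < v) (hvu : v < u + N) : ∃ e : Edge (ZMod N), e.Joins u v :=
  ⟨⟨s((u : ZMod N), (v : ZMod N)), fun h => huv.ne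
    (eq_of_intCast_eq (Sym2.mk_isDiag_iff.1 h) (by omega) (by omega))⟩, rfl⟩

theorem Edge.Joins.add_mul_right_iff (m : ℤ) : e.Joins u (v + m * N) ↔ e.Joins u v := by
  simp [Edge.Joins]

theorem cyclicRel_joined (T : Set (Edge (ZMod N))) : CyclicRel N (Joined T) where
  symm := fun ⟨e, heT, he⟩ => ⟨e, heT, he.symm⟩
  add_right := exists_congr fun _ => and_congr_right fun _ => by
    simpa using Edge.Joins.add_mul_right_iff 1

theorem periodicRel_joined {n : ℕ} (hT : ∀ e, e.shift (n : ZMod N) ∈ T ↔ e ∈ T) :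
    PeriodicRel N n (Joined T) where
  toCyclicRel := cyclicRel_joined T
  rot {u v} := by
    constructor
    · rintro ⟨e, heT, he⟩
      refine ⟨e.shift (-1 • (n : ZMod N)), (hT _).1 ?_, by simpa using he.shift (-1) n⟩
      rwa [Edge.shift_shift, neg_one_smul, neg_add_cancel, Edge.shift_zero]
    · rintro ⟨e, heT, he⟩
      exact ⟨e.shift n, (hT e).2 heT, by simpa using he.shift 1 n⟩

variable [NeZero N]

theorem zmod_sbtw_iff {x y z : ZMod N} : sbtw x y z ↔ x.val < y.val ∧ y.val < z.val ∨
    y.val < z.val ∧ z.val < x.val ∨ z.val < x.val ∧ x.val < y.val := by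
  obtain _ | N := N
  · exact absurd rfl (NeZero.ne 0)
  · exact Fin.sbtw_iff

theorem exists_intCast_eq_mem_Ico (a : ℤ) (z : ZMod N) :
    ∃ c : ℤ, (a ≤ c ∧ c < a + N) ∧ (c : ZMod N) = z := by
  have hN : (0 : ℤ) < N := by exact_mod_cast NeZero.pos N
  refine ⟨a + (z.val - a) % N, ⟨?_, ?_⟩, ?_⟩
  · have := Int.emod_nonneg (z.val - a) hN.ne'
    omega
  · have := Int.emod_lt_of_pos (z.val - a) hN
    omega
  · simp

theorem val_intCast_of_lt (hab : a < b) (hba : b < a + N) :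
    ((b : ZMod N).val : ℤ) = (a : ZMod N).val + (b - a) ∨
      ((b : ZMod N).val : ℤ) = (a : ZMod N).val + (b - a) - N := by
  have ha := ZMod.val_lt (a : ZMod N)
  have hb := ZMod.val_lt (b : ZMod N)
  obtain ⟨m, hm⟩ : ∃ m : ℤ, ((a : ZMod N).val + (b - a) : ℤ) = (b : ZMod N).val + m * N :=
    intCast_eq_iff_exists.1 (by simp)
  have hlo : -1 * (N : ℤ) < m * N := by omega
  have hhi : m * N < 2 * (N : ℤ) := by omega
  have hlo' := lt_of_mul_lt_mul_right hlo (Int.natCast_nonneg N)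
  have hhi' := lt_of_mul_lt_mul_right hhi (Int.natCast_nonneg N)
  obtain rfl | rfl : m = 0 ∨ m = 1 := by omega
  · exact Or.inl (by omega)
  · exact Or.inr (by omega)

theorem sbtw_intCast (hab : a < b) (hbc : b < c) (hca : c < a + N) :
    sbtw (a : ZMod N) (b : ZMod N) (c : ZMod N) := by
  have hc := ZMod.val_lt (c : ZMod N)
  have hvb := val_intCast_of_lt (N := N) hab (by omega)
  have hvc := val_intCast_of_lt (N := N) (hab.trans hbc) hca
  rw [zmod_sbtw_iff]
  omega

theorem exists_intCast_of_sbtw {z : ZMod N} (hab : a < b)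
    (h : sbtw (a : ZMod N) z (b : ZMod N)) : ∃ c : ℤ, a < c ∧ c < b ∧ (c : ZMod N) = z := by
  obtain ⟨c, ⟨hac, hca⟩, rfl⟩ := exists_intCast_eq_mem_Ico a z
  refine ⟨c, hac.lt_of_ne ?_, not_le.1 fun hbc => ?_, rfl⟩
  · rintro rfl
    exact sbtw_irrefl_left h
  · rcases hbc.eq_or_lt with rfl | hbc
    · exact sbtw_irrefl_right h
    · exact sbtw_asymm h (sbtw_intCast hab hbc hca).cyclic_right.cyclic_right

theorem Edge.Joins.crosses (he : e.Joins a b) (hf : f.Joins c d)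
    (h : a < c ∧ c < b ∧ b < d ∧ d < a + N) : e.Crosses f := by
  refine ⟨a, b, c, d, he, hf, sbtw_intCast h.1 h.2.1 (by omega), ?_⟩
  simpa using sbtw_intCast (N := N) (a := b) (b := d) (c := a + N) (by omega) (by omega) (by omega)

theorem Edge.Crosses.exists_joins_lt (h : e.Crosses f) (he : e.Joins a b) (hab : a < b)
    (hba : b < a + N) : ∃ c d : ℤ, (a < c ∧ c < b ∧ b < d ∧ d < a + N) ∧ f.Joins c d := by
  obtain ⟨x, y, z, w, he', hf, hxzy, hywx⟩ := h
  have hcast : ((a + N : ℤ) : ZMod N) = a := by simp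
  rcases Sym2.eq_iff.1 (Eq.trans (Eq.symm he) he') with ⟨rfl, rfl⟩ | ⟨rfl, rfl⟩
  · obtain ⟨c, hac, hcb, rfl⟩ := exists_intCast_of_sbtw hab hxzy
    obtain ⟨d, hbd, hda, rfl⟩ := exists_intCast_of_sbtw hba (by rwa [hcast])
    exact ⟨c, d, by omega, hf⟩
  · obtain ⟨c, hac, hcb, rfl⟩ := exists_intCast_of_sbtw hab hywx
    obtain ⟨d, hbd, hda, rfl⟩ := exists_intCast_of_sbtw hba (by rwa [hcast])
    exact ⟨c, d, by omega, Edge.Joins.symm hf⟩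

theorem Edge.Crosses.exists_joins_lt_lt (hef : e.Crosses f) (heg : e.Crosses g)
    (hfg : f.Crosses g) (he : e.Joins a b) (hab : a < b) (hba : b < a + N) :
    ∃ c x d y : ℤ, (a < c ∧ c < x ∧ x < b ∧ b < d ∧ d < y ∧ y < a + N) ∧
      ((f.Joins c d ∧ g.Joins x y) ∨ (g.Joins c d ∧ f.Joins x y)) := by
  obtain ⟨c, d, hcd, hf⟩ := hef.exists_joins_lt he hab hba
  obtain ⟨x, y, hxy, hg⟩ := heg.exists_joins_lt he hab hba
  obtain ⟨x', y', hxy', hg'⟩ := hfg.exists_joins_lt hf (by omega) (by omega)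
  rcases Sym2.eq_iff.1 (Eq.trans (Eq.symm hg) hg') with ⟨hx, hy⟩ | ⟨hx, hy⟩
  · obtain rfl := eq_of_intCast_eq hx (by omega) (by omega)
    obtain rfl : y = y' := by
      rcases lt_or_ge y' (y + N) with h | h
      · exact eq_of_intCast_eq hy (by omega) (by omega)
      · omega
    exact ⟨c, x, d, y, by omega, Or.inl ⟨hf, hg⟩⟩
  · obtain rfl := eq_of_intCast_eq hy (by omega) (by omega)
    obtain rfl : x = y' - N :=
      eq_of_intCast_eq (hx.trans (by simp)) (by omega) (by omega)
    exact ⟨_, c, y, d, by omega, Or.inr ⟨hg, hf⟩⟩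

theorem Edge.exists_joins (e : Edge (ZMod N)) : ∃ u v : ℤ, u < v ∧ v < u + N ∧ e.Joins u v := by
  obtain ⟨e, he⟩ := e
  induction e with
  | h x y =>
    have hx := ZMod.val_lt x
    have hy := ZMod.val_lt y
    have hxy : x.val ≠ y.val := fun h => he (ZMod.val_injective N h)
    rcases lt_or_gt_of_ne hxy with h | h
    · exact ⟨x.val, y.val, by omega, by omega, by simp [Edge.Joins]⟩
    · exact ⟨y.val, x.val, by omega, by omega, by simp [Edge.Joins, Sym2.eq_swap]⟩

theorem crossingFree_iff_isFree : CrossingFree 3 T ↔ IsFree N (Joined T) := by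
  rw [crossingFree_three_iff]
  constructor
  · rintro h a₁ a₂ a₃ b₁ b₂ b₃ ho ⟨e, heT, he⟩ ⟨f, hfT, hf⟩ ⟨g, hgT, hg⟩
    exact h e heT f hfT g hgT (he.crosses hf (by omega)) (he.crosses hg (by omega))
      (hf.crosses hg (by omega))
  · intro h e heT f hfT g hgT hef heg hfg
    obtain ⟨a, b, hab, hba, he⟩ := e.exists_joins
    obtain ⟨c, x, d, y, ho, ⟨hf, hg⟩ | ⟨hg, hf⟩⟩ := hef.exists_joins_lt_lt heg hfg he hab hba
    · exact h (by omega) ⟨e, heT, he⟩ ⟨f, hfT, hf⟩ ⟨g, hgT, hg⟩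
    · exact h (by omega) ⟨e, heT, he⟩ ⟨g, hgT, hg⟩ ⟨f, hfT, hf⟩

theorem blocked_of_crosses (hef : e.Crosses f) (heg : e.Crosses g) (hfg : f.Crosses g)
    (hf : f ∈ T) (hg : g ∈ T) (he : e.Joins u v) (huv : u < v) (hvu : v < u + N) :
    Blocked N (Joined T) u v := by
  obtain ⟨c, x, d, y, ho, ⟨hf', hg'⟩ | ⟨hg', hf'⟩⟩ := hef.exists_joins_lt_lt heg hfg he huv hvu
  · exact ⟨c, x, d, y, by omega, ⟨f, hf, hf'⟩, ⟨g, hg, hg'⟩⟩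
  · exact ⟨c, x, d, y, by omega, ⟨g, hg, hg'⟩, ⟨f, hf, hf'⟩⟩

theorem twoTri_iff_isPolyTriangulation : TwoTri N (Joined T) ↔ IsPolyTriangulation N 2 T := by
  constructor
  · intro h
    refine ⟨crossingFree_iff_isFree.2 h.free, fun T' hT' hTT' e he => ?_⟩
    obtain ⟨u, v, huv, hvu, hl⟩ := e.exists_joins
    rw [← joined_iff_mem hl] at he ⊢
    by_contra hno
    exact (crossingFree_iff_isFree.1 hT').not_blocked he
      ((h.blocked huv hvu hno).mono fun _ _ => Joined.mono hTT')
  · intro h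
    refine ⟨cyclicRel_joined T, crossingFree_iff_isFree.1 h.1, fun {u v} huv hvu hno => ?_⟩
    obtain ⟨e, he⟩ := exists_edge huv hvu
    have heT : ¬ CrossingFree 3 (insert e T) := fun hc => hno <| (joined_iff_mem he).2 <|
      h.2 hc (Set.subset_insert _ _) (Set.mem_insert _ _)
    obtain ⟨f, hf, g, hg, hef, heg, hfg⟩ := CrossingFree.exists_crosses_of_insert h.1 heT
    exact blocked_of_crosses hef heg hfg hf hg he huv hvu

end ZModLabels

section ShortLifts

variable {n : ℕ} {E F : Edge ℤ} {u v u' v' p r : ℤ}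

theorem coverLength_eq (hE : E.Joins u v) : coverLength E = (v - u).natAbs := by
  rw [coverLength, hE]
  rfl

theorem proj_eq_iff : proj n E = proj n F ↔ ∃ ℓ : ℤ, F = E.shift (ℓ • (n : ℤ)) := Quotient.eq

theorem Edge.Joins.proj_eq_iff (hE : E.Joins u v) (hF : F.Joins u' v') (huv : u < v)
    (huv' : u' < v') : proj n E = proj n F ↔ ∃ ℓ : ℤ, u' = u + ℓ * n ∧ v' = v + ℓ * n := by
  rw [Multitriangulation.proj_eq_iff]
  constructor
  · rintro ⟨ℓ, rfl⟩
    exact ⟨ℓ, hF.eq_int (hE.shift ℓ n) huv' (by omega)⟩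
  · rintro ⟨ℓ, rfl, rfl⟩
    exact ⟨ℓ, hF.unique (hE.shift ℓ n)⟩

/-- The edge `E` of the universal cover lies over the edge `e` of the `4n`-gon and goes around the
shorter way. -/
def IsShortLift (n : ℕ) (e : Edge (ZMod (4 * n))) (E : Edge ℤ) : Prop :=
  coverLength E ≤ 2 * n ∧ e.1 = E.1.map (fun i : ℤ => (i : ZMod (4 * n)))

variable {e f : Edge (ZMod (4 * n))}

theorem isShortLift_iff (hE : E.Joins u v) :
    IsShortLift n e E ↔ (v - u).natAbs ≤ 2 * n ∧ e.Joins u v := by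
  rw [IsShortLift, coverLength_eq hE, hE]
  rfl

theorem IsShortLift.shift (h : IsShortLift n e E) (ℓ : ℤ) :
    IsShortLift n (e.shift (ℓ • (n : ZMod (4 * n)))) (E.shift (ℓ • (n : ℤ))) := by
  obtain ⟨u, v, huv, hE⟩ := E.exists_joins_int
  rw [isShortLift_iff hE] at h
  rw [isShortLift_iff (hE.shift ℓ n), add_sub_add_right_eq_sub]
  exact ⟨h.1, h.2.shift ℓ n⟩

variable [NeZero n]

theorem exists_isShortLift (e : Edge (ZMod (4 * n))) : ∃ E, IsShortLift n e E := by
  obtain ⟨u, v, huv, hvu, he⟩ := e.exists_joins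
  rcases le_or_gt (v - u) (2 * n) with h | h
  · obtain ⟨E, hE⟩ := exists_int_edge huv
    exact ⟨E, (isShortLift_iff hE).2 ⟨by omega, he⟩⟩
  · obtain ⟨E, hE⟩ := exists_int_edge hvu
    exact ⟨E, (isShortLift_iff hE).2
      ⟨by omega, by simpa using (Edge.Joins.add_mul_right_iff 1).2 he.symm⟩⟩

/-- An edge with two short lifts has length `2n`; its short lifts differ by half a turn. -/
theorem IsShortLift.proj_eq (h : IsShortLift n e E) (h' : IsShortLift n e F) :
    proj n E = proj n F := by
  have hn : (0 : ℤ) < 4 * n := by exact_mod_cast Nat.mul_pos four_pos (NeZero.pos n)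
  obtain ⟨u, v, huv, hE⟩ := E.exists_joins_int
  obtain ⟨u', v', huv', hF⟩ := F.exists_joins_int
  rw [isShortLift_iff hE] at h
  rw [isShortLift_iff hF] at h'
  rw [hE.proj_eq_iff hF huv huv']
  have he := Eq.trans (Eq.symm h.2) h'.2
  simp only [Sym2.eq_iff, intCast_eq_iff_exists, Nat.cast_mul, Nat.cast_ofNat] at he
  rcases he with ⟨⟨k, hk⟩, l, hl⟩ | ⟨⟨k, hk⟩, l, hl⟩
  · have hlk : (l - k) * (4 * n : ℤ) = (v' - u') - (v - u) := by linarith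
    have hlk' : l - k = 0 := eq_of_mul_lt_mul 0 hn (by omega) (by omega)
    obtain rfl : l = k := sub_eq_zero.1 hlk'
    exact ⟨4 * l, by linarith, by linarith⟩
  · have hkl : (k - l) * (4 * n : ℤ) = (v' - u') + (v - u) := by linarith
    have hkl' : k - l = 1 := eq_of_mul_lt_mul 1 hn (by omega) (by omega)
    rw [hkl'] at hkl
    obtain rfl : k = l + 1 := by omega
    exact ⟨4 * l + 2, by linarith [show v - u = 2 * n by omega],
      by linarith [show v - u = 2 * n by omega]⟩

/-- The edge of the half-cylinder corresponding to an edge of the `4n`-gon: the class of its short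
lifts. -/
noncomputable def cylEdge (e : Edge (ZMod (4 * n))) : CylEdge n :=
  proj n (exists_isShortLift e).choose

theorem IsShortLift.cylEdge_eq (h : IsShortLift n e E) : cylEdge e = proj n E :=
  (exists_isShortLift e).choose_spec.proj_eq h

theorem cylEdge_eq_iff : cylEdge e = cylEdge f ↔ f ∈ e.orbit (n : ZMod (4 * n)) := by
  obtain ⟨E, hE⟩ := exists_isShortLift e
  obtain ⟨F, hF⟩ := exists_isShortLift f
  constructor
  · rw [hE.cylEdge_eq, hF.cylEdge_eq, proj_eq_iff]
    rintro ⟨ℓ, rfl⟩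
    exact ⟨ℓ, Subtype.ext (hF.2.trans (hE.shift ℓ).2.symm)⟩
  · rintro ⟨ℓ, rfl⟩
    rw [hE.cylEdge_eq, (hE.shift ℓ).cylEdge_eq, proj_eq_iff]
    exact ⟨ℓ, rfl⟩

theorem cylEdge_eq_iff_inOrbit (he : e.Joins p r) (hf : f.Joins u v) :
    cylEdge f = cylEdge e ↔ InOrbit n p r u v := by
  rw [eq_comm, cylEdge_eq_iff]
  constructor
  · rintro ⟨ℓ, rfl⟩
    have h := Eq.trans (Eq.symm (he.shift ℓ n)) hf
    simp only [Sym2.eq_iff, intCast_eq_iff_exists, Nat.cast_mul, Nat.cast_ofNat] at h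
    rcases h with ⟨⟨m, rfl⟩, k, rfl⟩ | ⟨⟨m, rfl⟩, k, rfl⟩
    · exact ⟨ℓ + 4 * m, k - m, Or.inl ⟨by ring, by ring⟩⟩
    · exact ⟨ℓ + 4 * k, m - k, Or.inr ⟨by ring, by ring⟩⟩
  · rintro ⟨j, k, ⟨rfl, rfl⟩ | ⟨rfl, rfl⟩⟩
    · exact ⟨j, hf.unique (by simpa using (Edge.Joins.add_mul_right_iff k).2 (he.shift j n))⟩
    · exact ⟨j, hf.unique (by simpa using (Edge.Joins.add_mul_right_iff k).2 (he.shift j n).symm)⟩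

theorem cylLength_cylEdge_le (e : Edge (ZMod (4 * n))) : cylLength (cylEdge e) ≤ 2 * n := by
  obtain ⟨E, hE⟩ := exists_isShortLift e
  rw [hE.cylEdge_eq]
  exact hE.1

theorem exists_cylEdge_eq {c : CylEdge n} (hc : cylLength c ≤ 2 * n) : ∃ e, cylEdge e = c := by
  obtain ⟨E, rfl⟩ := Quotient.exists_rep c
  obtain ⟨u, v, huv, hE⟩ := E.exists_joins_int
  replace hc : (v - u).natAbs ≤ 2 * n := coverLength_eq hE ▸ hc
  obtain ⟨e, he⟩ := exists_edge (N := 4 * n) huv (by have := NeZero.pos n; omega)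
  exact ⟨e, ((isShortLift_iff hE).2 ⟨hc, he⟩).cylEdge_eq⟩

theorem polyLength_eq (e : Edge (ZMod (4 * n))) : polyLength e = cylLength (cylEdge e) := by
  obtain ⟨E, hE⟩ := exists_isShortLift e
  obtain ⟨u, v, huv, hEuv⟩ := E.exists_joins_int
  rw [hE.cylEdge_eq]
  change _ = coverLength E
  rw [isShortLift_iff hEuv] at hE
  rw [coverLength_eq hEuv, polyLength, hE.2]
  change ((v : ZMod (4 * n)) - (u : ZMod (4 * n))).valMinAbs.natAbs = _
  rw [← Int.cast_sub]
  exact le_antisymm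
    (ZMod.natAbs_min_of_le_div_two (4 * n) _ _ (by simp) (ZMod.natAbs_valMinAbs_le _))
    (ZMod.natAbs_min_of_le_div_two (4 * n) _ _ (by simp) (by omega))

end ShortLifts

section ShortFree

variable {m : ℤ} {P : ℤ → ℤ → Prop}

/-- A set of edges of the `2m`-gon that has no `3`-crossing when every edge is only lifted to the
universal cover along its shorter way around. -/
def IsShortFree (m : ℤ) (P : ℤ → ℤ → Prop) : Prop :=
  ∀ ⦃a₁ a₂ a₃ b₁ b₂ b₃ : ℤ⦄, a₁ < a₂ ∧ a₂ < a₃ ∧ a₃ < b₁ ∧ b₁ < b₂ ∧ b₂ < b₃ →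
    b₁ ≤ a₁ + m ∧ b₂ ≤ a₂ + m ∧ b₃ ≤ a₃ + m → P a₁ b₁ → P a₂ b₂ → P a₃ b₃ → False

/-- The second edge of the crossing is long: half a turn of it, or of the first edge, gives a
`3`-crossing of short edges. -/
theorem IsShortFree.not_alternating (h : IsShortFree m P) (hP : PeriodicRel (2 * m) m P)
    {a₁ a₂ a₃ b₁ b₂ b₃ : ℤ}
    (ho : a₁ < a₂ ∧ a₂ < a₃ ∧ a₃ < b₁ ∧ b₁ < b₂ ∧ b₂ < b₃ ∧ b₃ < a₁ + 2 * m)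
    (hlen : b₁ ≤ a₁ + m ∧ a₂ + m ≤ b₂ ∧ b₃ ≤ a₃ + m) (h₁ : P a₁ b₁) (h₂ : P a₂ b₂) :
    ¬ P a₃ b₃ := by
  intro h₃
  have hb₃ : b₃ ≤ a₂ + m := by
    by_contra!
    exact h (a₂ := b₂ - m) (b₂ := a₂ + m) (by omega) (by omega) h₁
      (hP.move_symm h₂ (-1) 1 (by ring) (by ring)) h₃
  have hb₁ : a₂ + 2 * m ≤ b₁ + m := by
    by_contra!
    exact h (a₂ := a₁ + m) (b₂ := b₁ + m) (by omega) (by omega) h₃ (hP.rot.2 h₁) (hP.turn h₂)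
  omega

theorem isShortFree_iff_isFree (hP : PeriodicRel (2 * m) m P) :
    IsShortFree m P ↔ IsFree (2 * m) P := by
  refine ⟨fun h a₁ a₂ a₃ b₁ b₂ b₃ ho h₁ h₂ h₃ => ?_, fun h a₁ a₂ a₃ b₁ b₂ b₃ ho hlen =>
    h (by omega)⟩
  have t₁ := hP.turn h₁
  have t₂ := hP.turn h₂
  have t₃ := hP.turn h₃
  rcases le_total b₁ (a₁ + m) with l₁ | l₁ <;> rcases le_total b₂ (a₂ + m) with l₂ | l₂ <;>
    rcases le_total b₃ (a₃ + m) with l₃ | l₃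
  · exact h (by omega) ⟨l₁, l₂, l₃⟩ h₁ h₂ h₃
  · exact h (by omega) (by omega) t₃ (hP.turn t₁) (hP.turn t₂)
  · exact h.not_alternating hP ho ⟨l₁, l₂, l₃⟩ h₁ h₂ h₃
  · exact h (by omega) (by omega) t₂ t₃ (hP.turn t₁)
  · exact h (by omega) (by omega) h₂ h₃ t₁
  · exact h.not_alternating hP (by omega) ⟨l₂, l₃, by omega⟩ h₂ h₃ t₁
  · exact h (by omega) (by omega) h₃ t₁ t₂
  · exact h (by omega) (by omega) t₁ t₂ t₃

end ShortFree

section Wrap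

variable {n : ℕ} [NeZero n] {S : Set (CylEdge n)} {e : Edge (ZMod (4 * n))} {u v : ℤ}

/-- The edges of the `4n`-gon corresponding to a set of edges of the half-cylinder. -/
def wrap (S : Set (CylEdge n)) : Set (Edge (ZMod (4 * n))) := cylEdge ⁻¹' S

theorem joined_wrap_iff (he : e.Joins u v) : Joined (wrap S) u v ↔ cylEdge e ∈ S :=
  joined_iff_mem he

theorem shift_mem_wrap (S : Set (CylEdge n)) (e : Edge (ZMod (4 * n))) :
    e.shift (n : ZMod (4 * n)) ∈ wrap S ↔ e ∈ wrap S := by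
  rw [wrap, Set.mem_preimage, Set.mem_preimage, ← cylEdge_eq_iff.2 ⟨1, by rw [one_smul]⟩]

theorem periodicRel_joined_wrap (S : Set (CylEdge n)) :
    PeriodicRel (4 * n) n (Joined (wrap S)) := by
  simpa using periodicRel_joined (shift_mem_wrap S)

theorem joined_lift_iff_of_le (huv : u < v) (hvu : v ≤ u + 2 * n) :
    Joined (lift S) u v ↔ Joined (wrap S) u v := by
  obtain ⟨e, he⟩ := exists_edge (N := 4 * n) huv (by have := NeZero.pos n; omega)
  obtain ⟨E, hE⟩ := exists_int_edge huv
  rw [joined_iff_mem hE, joined_wrap_iff he, ((isShortLift_iff hE).2 ⟨by omega, he⟩).cylEdge_eq]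
  rfl

theorem joined_lift_iff (hS : ∀ c ∈ S, cylLength c ≤ 2 * n) (huv : u < v) :
    Joined (lift S) u v ↔ v ≤ u + 2 * n ∧ Joined (wrap S) u v := by
  refine ⟨fun h => ?_, fun h => (joined_lift_iff_of_le huv h.1).2 h.2⟩
  suffices hvu : v ≤ u + 2 * n from ⟨hvu, (joined_lift_iff_of_le huv hvu).1 h⟩
  obtain ⟨E, hES, hE⟩ := h
  have hlen : coverLength E ≤ 2 * n := hS _ hES
  rw [coverLength_eq hE] at hlen
  omega

/-- An edge longer than `2n` crosses its translates by `n` and `2n`. -/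
theorem cylLength_le_of_crossingFree (h : CrossingFree 3 (lift S)) {c : CylEdge n} (hc : c ∈ S) :
    cylLength c ≤ 2 * n := by
  obtain ⟨E, rfl⟩ := Quotient.exists_rep c
  obtain ⟨u, v, huv, hE⟩ := E.exists_joins_int
  have hshift : ∀ ℓ : ℤ, Joined (lift S) (u + ℓ * n) (v + ℓ * n) := fun ℓ =>
    ⟨E.shift (ℓ • (n : ℤ)), by
      rwa [lift, Set.mem_preimage, ← proj_eq_iff.2 ⟨ℓ, rfl⟩], hE.shift ℓ n⟩
  change coverLength E ≤ 2 * n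
  rw [coverLength_eq hE]
  by_contra! hlen
  have hn := NeZero.pos n
  exact crossingFree_int_iff.1 h (by omega) (hshift 0) (hshift 1) (hshift 2)

theorem crossingFree_lift_iff (hS : ∀ c ∈ S, cylLength c ≤ 2 * n) :
    CrossingFree 3 (lift S) ↔ IsFree (4 * n) (Joined (wrap S)) := by
  have hP := periodicRel_joined_wrap S
  have h4 : (4 * n : ℤ) = 2 * (2 * n) := by ring
  have hP' : PeriodicRel (2 * (2 * n)) (2 * n) (Joined (wrap S)) :=
    ⟨h4 ▸ hP.toCyclicRel, hP.rot_mul 2⟩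
  rw [crossingFree_int_iff, h4, ← isShortFree_iff_isFree hP']
  constructor
  · intro h a₁ a₂ a₃ b₁ b₂ b₃ ho hlen h₁ h₂ h₃
    exact h ho ((joined_lift_iff hS (by omega)).2 ⟨hlen.1, h₁⟩)
      ((joined_lift_iff hS (by omega)).2 ⟨hlen.2.1, h₂⟩)
      ((joined_lift_iff hS (by omega)).2 ⟨hlen.2.2, h₃⟩)
  · intro h a₁ a₂ a₃ b₁ b₂ b₃ ho h₁ h₂ h₃
    rw [joined_lift_iff hS (by omega)] at h₁ h₂ h₃
    exact h ho ⟨h₁.1, h₂.1, h₃.1⟩ h₁.2 h₂.2 h₃.2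

theorem joined_wrap_of_isFree_or_inOrbit
    (h : Maximal (fun S : Set (CylEdge n) => CrossingFree 3 (lift S)) S) (huv : u < v)
    (hvu : v < u + 4 * n)
    (hF : IsFree (4 * n) (fun x y => Joined (wrap S) x y ∨ InOrbit n u v x y)) :
    Joined (wrap S) u v := by
  obtain ⟨e, he⟩ := exists_edge (N := 4 * n) huv (by omega)
  rw [joined_wrap_iff he]
  refine h.2 (y := insert (cylEdge e) S) ?_ (Set.subset_insert _ _) (Set.mem_insert _ _)
  refine (crossingFree_lift_iff ?_).2 (hF.mono ?_)
  · rintro c (rfl | hc)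
    · exact cylLength_cylEdge_le e
    · exact cylLength_le_of_crossingFree h.1 hc
  · rintro x y ⟨f, hfe | hf, hxy⟩
    · exact Or.inr ((cylEdge_eq_iff_inOrbit he hxy).1 hfe)
    · exact Or.inl ⟨f, hf, hxy⟩

theorem maximal_iff_twoTri (hS : ∀ c ∈ S, cylLength c ≤ 2 * n) :
    Maximal (fun S : Set (CylEdge n) => CrossingFree 3 (lift S)) S ↔
      TwoTri (4 * n) (Joined (wrap S)) := by
  have hn : (0 : ℤ) < n := by exact_mod_cast NeZero.pos n
  have hP := periodicRel_joined_wrap S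
  constructor
  · intro h
    have hF := (crossingFree_lift_iff hS).1 h.1
    refine ⟨hP.toCyclicRel, hF, fun {u v} huv hvu hno => ?_⟩
    by_contra hnb
    rcases isFree_or_inOrbit hP hF hn huv hvu hnb with hf | ⟨_, hno', hf⟩ | ⟨_, hno', hf⟩
    · exact hno (joined_wrap_of_isFree_or_inOrbit h huv hvu hf)
    · exact hno' (joined_wrap_of_isFree_or_inOrbit h (by omega) (by omega) hf)
    · exact hno' (joined_wrap_of_isFree_or_inOrbit h (by omega) (by omega) hf)
  · refine fun h => ⟨(crossingFree_lift_iff hS).2 h.free, fun S' hS' hSS' c hc => ?_⟩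
    have hlen := fun c hc => cylLength_le_of_crossingFree hS' (c := c) hc
    obtain ⟨e, rfl⟩ := exists_cylEdge_eq (hlen c hc)
    obtain ⟨u, v, huv, hvu, he⟩ := e.exists_joins
    rw [← joined_wrap_iff he] at hc ⊢
    by_contra hno
    exact ((crossingFree_lift_iff hlen).1 hS').not_blocked hc
      ((h.blocked huv (by omega) hno).mono fun _ _ => Joined.mono (Set.preimage_mono hSS'))

end Wrap

section Correspondence

variable {n : ℕ} [NeZero n] {S : Set (CylEdge n)} {T : Set (Edge (ZMod (4 * n)))}

theorem CylTriangulation.cylLength_le (S : CylTriangulation n 2) : ∀ c ∈ S.1, cylLength c ≤ 2 * n :=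
  fun _ hc => cylLength_le_of_crossingFree S.2.1 hc

theorem CylTriangulation.periodicTwoTri (S : CylTriangulation n 2) :
    PeriodicTwoTri n (Joined (wrap S.1)) where
  toTwoTri := (maximal_iff_twoTri S.cylLength_le).1 S.2
  rot := (periodicRel_joined_wrap S.1).rot
  pos := by exact_mod_cast NeZero.pos n

theorem image_wrap (hS : ∀ c ∈ S, cylLength c ≤ 2 * n) : cylEdge '' wrap S = S :=
  Set.image_preimage_eq_of_subset fun c hc => exists_cylEdge_eq (hS c hc)

theorem wrap_injOn : Set.InjOn wrap {S : Set (CylEdge n) | ∀ c ∈ S, cylLength c ≤ 2 * n} :=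
  fun S hS S' hS' h => by rw [← image_wrap hS, ← image_wrap hS', h]

theorem shift_zsmul_mem_iff (hT : ∀ e, e.shift (n : ZMod (4 * n)) ∈ T ↔ e ∈ T) (ℓ : ℤ)
    (e : Edge (ZMod (4 * n))) : e.shift (ℓ • (n : ZMod (4 * n))) ∈ T ↔ e ∈ T := by
  obtain ⟨u, v, -, -, he⟩ := e.exists_joins
  rw [← joined_iff_mem he, ← joined_iff_mem (he.shift ℓ n)]
  exact (periodicRel_joined hT).rot_mul ℓ

theorem wrap_image (hT : ∀ e, e.shift (n : ZMod (4 * n)) ∈ T ↔ e ∈ T) :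
    wrap (cylEdge '' T) = T := by
  refine Set.Subset.antisymm ?_ (Set.subset_preimage_image _ _)
  rintro e ⟨f, hf, hfe⟩
  obtain ⟨ℓ, rfl⟩ := cylEdge_eq_iff.1 hfe
  exact (shift_zsmul_mem_iff hT ℓ f).2 hf

theorem twoTri_four_mul_iff : TwoTri (4 * n) (Joined T) ↔ IsPolyTriangulation (4 * n) 2 T := by
  simpa using twoTri_iff_isPolyTriangulation (T := T)

/-- The `2`-triangulations of the half-cylinder as `n`-periodic `2`-triangulations of the
`4n`-gon. -/
noncomputable def wrapEquiv (n : ℕ) [NeZero n] :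
    CylTriangulation n 2 ≃ PeriodicTriangulation (4 * n) n 2 where
  toFun S := ⟨wrap S.1, twoTri_four_mul_iff.1 S.periodicTwoTri.toTwoTri, shift_mem_wrap S.1⟩
  invFun T := ⟨cylEdge '' T.1,
    (maximal_iff_twoTri (by rintro _ ⟨e, -, rfl⟩; exact cylLength_cylEdge_le e)).2
      (by rw [wrap_image T.2.2]; exact twoTri_four_mul_iff.2 T.2.1)⟩
  left_inv S := Subtype.ext (image_wrap S.cylLength_le)
  right_inv T := Subtype.ext (wrap_image T.2.2)

theorem wrap_exchange (S : Set (CylEdge n)) (e f : Edge (ZMod (4 * n))) :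
    wrap ((S \ {cylEdge e}) ∪ {cylEdge f}) =
      (wrap S \ e.orbit (n : ZMod (4 * n))) ∪ f.orbit (n : ZMod (4 * n)) := by
  ext g
  simp only [wrap, Set.mem_preimage, Set.mem_union, Set.mem_sdiff, Set.mem_singleton_iff]
  rw [← cylEdge_eq_iff, ← cylEdge_eq_iff, @eq_comm _ (cylEdge e), @eq_comm _ (cylEdge f)]

theorem cylLength_le_of_mem_exchange (hS : ∀ c ∈ S, cylLength c ≤ 2 * n) (c : CylEdge n)
    (f : Edge (ZMod (4 * n))) : ∀ d ∈ (S \ {c}) ∪ {cylEdge f}, cylLength d ≤ 2 * n := by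
  rintro d (hd | rfl)
  · exact hS d hd.1
  · exact cylLength_cylEdge_le f

theorem isPolyFlip_wrapEquiv_iff {S S' : CylTriangulation n 2} :
    IsPolyFlip (wrapEquiv n S) (wrapEquiv n S') ↔ IsCylFlip S S' := by
  constructor
  · rintro ⟨e, he, hlen, f, hf, h⟩
    refine ⟨cylEdge e, he, ⟨by rwa [← polyLength_eq], cylLength_cylEdge_le e⟩, cylEdge f, hf, ?_⟩
    exact wrap_injOn S'.cylLength_le (cylLength_le_of_mem_exchange S.cylLength_le _ f)
      (h.trans (wrap_exchange S.1 e f).symm)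
  · rintro ⟨c, hc, hlen, d, hd, h⟩
    obtain ⟨e, rfl⟩ := exists_cylEdge_eq hlen.2
    obtain ⟨f, rfl⟩ := exists_cylEdge_eq (S'.cylLength_le d (h ▸ Or.inr rfl))
    exact ⟨e, hc, by rw [polyLength_eq]; exact hlen.1, f, hd,
      (congrArg wrap h).trans (wrap_exchange S.1 e f)⟩

/-- `wrapEquiv` as an isomorphism of the flip graphs. -/
noncomputable def wrapIso (n : ℕ) [NeZero n] :
    cylFlipGraph n 2 ≃g periodicFlipGraph (4 * n) n 2 where
  toEquiv := wrapEquiv n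
  map_rel_iff' {S S'} := by
    simp only [cylFlipGraph, periodicFlipGraph, SimpleGraph.fromRel_adj,
      isPolyFlip_wrapEquiv_iff, ne_eq, EmbeddingLike.apply_eq_iff_eq]

theorem mem_wrapIso_iff (S : CylTriangulation n 2) (f : Edge (ZMod (4 * n))) :
    f ∈ (wrapIso n S).1 ↔
      ∃ e ∈ lift S.1, f.1 = e.1.map (fun i : ℤ => (i : ZMod (4 * n))) := by
  change cylEdge f ∈ S.1 ↔ _
  constructor
  · intro hf
    obtain ⟨E, hE⟩ := exists_isShortLift f
    exact ⟨E, by rwa [lift, Set.mem_preimage, ← hE.cylEdge_eq], hE.2⟩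
  · rintro ⟨E, hE, hf⟩
    have hlift : IsShortLift n f E := ⟨S.cylLength_le _ hE, hf⟩
    rwa [hlift.cylEdge_eq]

end Correspondence

section Flips

variable {n : ℕ} {S : Set (CylEdge n)} {c d : CylEdge n} {p r u v x y : ℤ}

/-- The `2`-relevant edges of a set of edges of the half-cylinder. -/
def relevant (S : Set (CylEdge n)) : Set (CylEdge n) := {c ∈ S | 2 < cylLength c}

theorem relevant_exchange (hd : 2 < cylLength d) :
    relevant ((S \ {c}) ∪ {d}) = insert d (relevant S \ {c}) := by
  ext x
  simp only [relevant, Set.mem_ofPred_eq, Set.mem_union, Set.mem_sdiff, Set.mem_singleton_iff,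
    Set.mem_insert_iff]
  constructor
  · rintro ⟨⟨hx, hxc⟩ | rfl, hlen⟩
    · exact Or.inr ⟨⟨hx, hlen⟩, hxc⟩
    · exact Or.inl rfl
  · rintro (rfl | ⟨⟨hx, hlen⟩, hxc⟩)
    · exact ⟨Or.inr rfl, hd⟩
    · exact ⟨Or.inl ⟨hx, hxc⟩, hlen⟩

theorem notMem_exchange (hc : c ∈ S) (hd : d ∉ S) : c ∉ (S \ {c}) ∪ {d} := by
  rintro (hcc | rfl)
  · exact hcc.2 rfl
  · exact hd hc

theorem exchange_exchange (hc : c ∈ S) (hd : d ∉ S) :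
    ((S \ {c}) ∪ {d}) \ {d} ∪ {c} = S := by
  have hd' : d ∉ S \ {c} := fun h => hd h.1
  rw [Set.union_singleton, Set.union_singleton, Set.insert_sdiff_self_of_notMem hd',
    Set.insert_sdiff_self_of_mem hc]

theorem IsCylFlip.ne {k : ℕ} {S S' : CylTriangulation n k} (h : IsCylFlip S S') : S ≠ S' := by
  rintro rfl
  obtain ⟨c, -, -, d, hd, h⟩ := h
  exact hd (h ▸ Or.inr rfl)

variable [NeZero n]

theorem finite_of_cylLength_le (hS : ∀ c ∈ S, cylLength c ≤ 2 * n) : S.Finite := by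
  have : Finite (Edge (ZMod (4 * n))) := inferInstanceAs (Finite {e : Sym2 (ZMod (4 * n)) // _})
  exact (Set.finite_range (cylEdge (n := n))).subset fun c hc => exists_cylEdge_eq (hS c hc)

theorem exists_maximal_supset (hS : CrossingFree 3 (lift S)) :
    ∃ S' : CylTriangulation n 2, S ⊆ S'.1 := by
  have hshort : {c : CylEdge n | cylLength c ≤ 2 * n}.Finite :=
    finite_of_cylLength_le fun _ hc => hc
  have hfin : {S : Set (CylEdge n) | CrossingFree 3 (lift S)}.Finite :=
    hshort.finite_subsets.subset fun _ hT _ hc => cylLength_le_of_crossingFree hT hc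
  obtain ⟨S', hSS', hmax⟩ := hfin.exists_le_maximal hS
  exact ⟨⟨S', hmax⟩, hSS'⟩

theorem joined_wrap_exchange_iff {e f : Edge (ZMod (4 * n))} (he : e.Joins p r)
    (hf : f.Joins x y) (huv : u < v) (hvu : v < u + 4 * n) :
    Joined (wrap ((S \ {cylEdge e}) ∪ {cylEdge f})) u v ↔
      exchange n (Joined (wrap S)) p r x y u v := by
  obtain ⟨g, hg⟩ := exists_edge (N := 4 * n) huv (by push_cast; exact hvu)
  rw [joined_wrap_iff hg, exchange, joined_wrap_iff hg, ← cylEdge_eq_iff_inOrbit he hg,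
    ← cylEdge_eq_iff_inOrbit hf hg]
  rfl

theorem crossingFree_exchange_iff (hS : ∀ c ∈ S, cylLength c ≤ 2 * n)
    {e f : Edge (ZMod (4 * n))} (he : e.Joins p r) (hf : f.Joins x y) :
    CrossingFree 3 (lift ((S \ {cylEdge e}) ∪ {cylEdge f})) ↔
      IsFree (4 * n) (exchange n (Joined (wrap S)) p r x y) := by
  rw [crossingFree_lift_iff (cylLength_le_of_mem_exchange hS _ f)]
  refine forall₃_congr fun a₁ a₂ a₃ => forall₃_congr fun b₁ b₂ b₃ => forall_congr' fun ho => ?_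
  rw [joined_wrap_exchange_iff he hf (by omega) (by omega),
    joined_wrap_exchange_iff he hf (by omega) (by omega),
    joined_wrap_exchange_iff he hf (by omega) (by omega)]

namespace CylTriangulation

variable (S : CylTriangulation n 2)

theorem proj_mem_relevant_iff {E : Edge ℤ} (hE : E.Joins u v) (huv : u < v) :
    proj n E ∈ relevant S.1 ↔ (3 ≤ v - u ∧ v - u ≤ 2 * n) ∧ Joined (wrap S.1) u v := by
  change E ∈ lift S.1 ∧ 2 < coverLength E ↔ _
  rw [← joined_iff_mem hE, joined_lift_iff S.cylLength_le huv, coverLength_eq hE]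
  constructor
  · rintro ⟨⟨hvu, h⟩, hlen⟩
    exact ⟨by omega, h⟩
  · rintro ⟨hlen, h⟩
    exact ⟨⟨by omega, h⟩, by omega⟩

theorem exists_joins_of_mem_relevant (hc : c ∈ relevant S.1) :
    ∃ (e : Edge (ZMod (4 * n))) (p r : ℤ), cylEdge e = c ∧ e.Joins p r ∧ p + 3 ≤ r ∧
      r ≤ p + 2 * n ∧ Joined (wrap S.1) p r := by
  obtain ⟨E, rfl⟩ := Quotient.exists_rep c
  obtain ⟨p, r, hpr, hE⟩ := E.exists_joins_int
  obtain ⟨hlen, hprS⟩ := (S.proj_mem_relevant_iff hE hpr).1 hc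
  obtain ⟨e, he⟩ := exists_edge (N := 4 * n) hpr (by omega)
  exact ⟨e, p, r, ((isShortLift_iff hE).2 ⟨by omega, he⟩).cylEdge_eq, he, by omega, by omega, hprS⟩

theorem exists_mem_relevantEdges (hc : c ∈ relevant S.1) :
    ∃ α ∈ relevantEdges n (Joined (wrap S.1)), ∀ E : Edge ℤ, E.Joins α.1 (α.1 + α.2) →
      proj n E = c := by
  have hn : (0 : ℤ) < n := by exact_mod_cast NeZero.pos n
  obtain ⟨F, rfl⟩ := Quotient.exists_rep c
  obtain ⟨u, v, huv, hF⟩ := F.exists_joins_int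
  obtain ⟨hlen, huvS⟩ := (S.proj_mem_relevant_iff hF huv).1 hc
  refine ⟨(u % n, v - u), mem_relevantEdges.2 ⟨⟨⟨u.emod_nonneg hn.ne', u.emod_lt_of_pos hn⟩, hlen⟩,
    (periodicRel_joined_wrap S.1).emod huvS⟩, fun E hE => ?_⟩
  have hu := Int.emod_add_mul_ediv u n
  exact (hE.proj_eq_iff hF (by dsimp only; omega) huv).2
    ⟨u / n, by linarith, by linarith⟩

theorem eq_of_proj_eq {α β : ℤ × ℤ} (hα : α ∈ relevantEdges n (Joined (wrap S.1)))
    (hβ : β ∈ relevantEdges n (Joined (wrap S.1))) {E F : Edge ℤ} (hE : E.Joins α.1 (α.1 + α.2))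
    (hF : F.Joins β.1 (β.1 + β.2)) (h : proj n E = proj n F) : α = β := by
  rw [mem_relevantEdges] at hα hβ
  obtain ⟨ℓ, h₁, h₂⟩ := (hE.proj_eq_iff hF (by omega) (by omega)).1 h
  have hℓ : ℓ = 0 := eq_of_mul_lt_mul (n := n) 0 (by omega) (by omega) (by omega)
  rw [hℓ, zero_mul] at h₁ h₂
  exact Prod.ext (by omega) (by omega)

theorem encard_relevant : (relevant S.1).encard = (2 * (n - 1) : ℕ) := by
  have hn : (0 : ℤ) < n := by exact_mod_cast NeZero.pos n
  have hlt (α : relevantEdges n (Joined (wrap S.1))) : α.1.1 < α.1.1 + α.1.2 := by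
    have := mem_relevantEdges.1 α.2
    omega
  choose E hE using fun α => exists_int_edge (hlt α)
  have hmem (α) : proj n (E α) ∈ relevant S.1 := by
    have hα := mem_relevantEdges.1 α.2
    exact (S.proj_mem_relevant_iff (hE α) (hlt α)).2 ⟨by omega, hα.2⟩
  have hbij : Function.Bijective fun α => (⟨proj n (E α), hmem α⟩ : relevant S.1) := by
    constructor
    · intro α β h
      exact Subtype.ext (S.eq_of_proj_eq α.2 β.2 (hE α) (hE β) (congrArg Subtype.val h))
    · rintro ⟨c, hc⟩
      obtain ⟨α, hα, h⟩ := S.exists_mem_relevantEdges hc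
      exact ⟨⟨α, hα⟩, Subtype.ext (h _ (hE _))⟩
  have hcard := S.periodicTwoTri.card_relevantEdges S.periodicTwoTri.toPeriodicRel hn
  rw [← Set.encard_congr (Equiv.ofBijective _ hbij), Set.encard_coe_eq_coe_finsetCard]
  congr 1
  omega

theorem mem_of_cylLength_le_two (hc : cylLength c ≤ 2) (hcn : cylLength c ≤ 2 * n) :
    c ∈ S.1 := by
  obtain ⟨E, rfl⟩ := Quotient.exists_rep c
  obtain ⟨u, v, huv, hE⟩ := E.exists_joins_int
  change coverLength E ≤ _ at hc hcn
  rw [coverLength_eq hE] at hc hcn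
  exact (joined_iff_mem hE).1 ((joined_lift_iff_of_le huv (by omega)).2
    (S.periodicTwoTri.mem_of_short huv (by omega) (by omega)))

theorem two_lt_cylLength_of_notMem (hc : c ∉ S.1) (hcn : cylLength c ≤ 2 * n) :
    2 < cylLength c := by
  by_contra! h
  exact hc (S.mem_of_cylLength_le_two h hcn)

theorem finite_relevant : (relevant S.1).Finite :=
  (finite_of_cylLength_le S.cylLength_le).subset fun _ hc => hc.1

/-- All `2`-triangulations have equally many relevant edges, so a crossing-free set with that many
relevant edges has no room to grow. -/
theorem maximal_exchange (hc : c ∈ relevant S.1) (hd : d ∉ S.1)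
    (h : CrossingFree 3 (lift ((S.1 \ {c}) ∪ {d}))) :
    Maximal (fun S : Set (CylEdge n) => CrossingFree 3 (lift S)) ((S.1 \ {c}) ∪ {d}) := by
  have hdn : cylLength d ≤ 2 * n := cylLength_le_of_crossingFree h (Or.inr rfl)
  obtain ⟨S', hS'⟩ := exists_maximal_supset h
  have hrel : relevant ((S.1 \ {c}) ∪ {d}) = relevant S'.1 := by
    refine S'.finite_relevant.eq_of_subset_of_encard_le' (fun x hx => ⟨hS' hx.1, hx.2⟩) ?_
    rw [relevant_exchange (S.two_lt_cylLength_of_notMem hd hdn),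
      Set.encard_exchange (fun hdS => hd hdS.1) hc, S.encard_relevant, S'.encard_relevant]
  suffices heq : (S.1 \ {c}) ∪ {d} = S'.1 from heq ▸ S'.2
  refine Set.Subset.antisymm hS' fun x hx => ?_
  rcases lt_or_ge 2 (cylLength x) with hlen | hlen
  · exact (hrel.ge ⟨hx, hlen⟩).1
  · refine Or.inl ⟨S.mem_of_cylLength_le_two hlen (S'.cylLength_le x hx), ?_⟩
    rintro rfl
    exact hlen.not_gt hc.2

theorem exists_unique_flip (hc : c ∈ relevant S.1) :
    ∃! S' : CylTriangulation n 2, ∃ d ∉ S.1, S'.1 = (S.1 \ {c}) ∪ {d} := by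
  obtain ⟨e, p, r, rfl, he, hpr, hrp, hprS⟩ := S.exists_joins_of_mem_relevant hc
  obtain ⟨x, y, hxy, huniq⟩ := S.periodicTwoTri.exists_unique_isExchange (by omega) (by omega) hprS
  obtain ⟨f, hf⟩ := exists_edge (N := 4 * n) hxy.lt.1 (by have := hxy.lt.2; omega)
  have hfS : cylEdge f ∉ S.1 := fun h => hxy.notMem ((joined_wrap_iff hf).2 h)
  refine ⟨⟨_, S.maximal_exchange hc hfS ((crossingFree_exchange_iff S.cylLength_le he hf).2
    hxy.free)⟩, ⟨_, hfS, rfl⟩, ?_⟩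
  rintro S' ⟨d, hd, hS'⟩
  obtain ⟨g, rfl⟩ := exists_cylEdge_eq (S'.cylLength_le d (by rw [hS']; exact Or.inr rfl))
  obtain ⟨x', y', hlt, hlt', hg⟩ := g.exists_joins
  have hfree : CrossingFree 3 (lift S'.1) := S'.2.1
  rw [hS', crossingFree_exchange_iff S.cylLength_le he hg] at hfree
  have horb := huniq x' y' ⟨⟨hlt, by omega⟩, fun h => hd ((joined_wrap_iff hg).1 h), hfree⟩
  exact Subtype.ext (by rw [hS', (cylEdge_eq_iff_inOrbit hf hg).2 horb])

end CylTriangulation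

variable {S S' : CylTriangulation n 2}

theorem isCylFlip_iff :
    IsCylFlip S S' ↔ ∃ c ∈ relevant S.1, ∃ d ∉ S.1, S'.1 = (S.1 \ {c}) ∪ {d} := by
  constructor
  · rintro ⟨c, hc, hlen, h⟩
    exact ⟨c, ⟨hc, hlen.1⟩, h⟩
  · rintro ⟨c, hc, h⟩
    exact ⟨c, hc.1, ⟨hc.2, S.cylLength_le c hc.1⟩, h⟩

theorem IsCylFlip.symm (h : IsCylFlip S S') : IsCylFlip S' S := by
  obtain ⟨c, hc, -, d, hd, h⟩ := h
  have hdS' : d ∈ S'.1 := h ▸ Or.inr rfl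
  have hdn := S'.cylLength_le d hdS'
  refine ⟨d, hdS', ⟨S.two_lt_cylLength_of_notMem hd hdn, hdn⟩, c, ?_, ?_⟩
  · rw [h]
    exact notMem_exchange hc hd
  · rw [h, exchange_exchange hc hd]

theorem cylFlipGraph_adj_iff : (cylFlipGraph n 2).Adj S S' ↔ IsCylFlip S S' := by
  rw [cylFlipGraph, SimpleGraph.fromRel_adj]
  exact ⟨fun h => h.2.elim id IsCylFlip.symm, fun h => ⟨h.ne, Or.inl h⟩⟩

theorem encard_neighborSet_cylFlipGraph (S : CylTriangulation n 2) :
    ((cylFlipGraph n 2).neighborSet S).encard = (2 * (n - 1) : ℕ) := by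
  choose flip hflip huniq using fun c : relevant S.1 => S.exists_unique_flip c.2
  have hadj (c) : flip c ∈ (cylFlipGraph n 2).neighborSet S :=
    cylFlipGraph_adj_iff.2 (isCylFlip_iff.2 ⟨c, c.2, hflip c⟩)
  have hbij : Function.Bijective
      fun c => (⟨flip c, hadj c⟩ : (cylFlipGraph n 2).neighborSet S) := by
    constructor
    · intro c c' hcc'
      by_contra! hne
      have heq : flip c = flip c' := congrArg Subtype.val hcc'
      obtain ⟨d, hd, h⟩ := hflip c
      obtain ⟨d', -, h'⟩ := hflip c'
      apply notMem_exchange c.2.1 hd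
      rw [← h, heq, h']
      exact Or.inl ⟨c.2.1, fun h => hne (Subtype.ext h)⟩
    · rintro ⟨S', hS'⟩
      obtain ⟨c, hc, h⟩ := isCylFlip_iff.1 (cylFlipGraph_adj_iff.1 hS')
      exact ⟨⟨c, hc⟩, Subtype.ext (huniq ⟨c, hc⟩ S' h).symm⟩
  rw [← S.encard_relevant, Set.encard_congr (Equiv.ofBijective _ hbij)]

end Flips

section Regular

variable {V : Type*} {G : SimpleGraph V} {d : ℕ}

theorem exists_isRegularOfDegree (h : ∀ v, (G.neighborSet v).encard = d) :
    ∃ _ : G.LocallyFinite, G.IsRegularOfDegree d := by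
  let _ : G.LocallyFinite := fun v => (Set.finite_of_encard_eq_coe (h v)).fintype
  refine ⟨inferInstance, fun v => ?_⟩
  have hv := h v
  rw [Set.encard_eq_coe_toFinset_card] at hv
  rw [← G.card_neighborSet_eq_degree, ← Set.toFinset_card]
  exact_mod_cast hv

theorem encard_neighborSet_eq {W : Type*} {H : SimpleGraph W} (φ : G ≃g H) (v : V) :
    (G.neighborSet v).encard = (H.neighborSet (φ v)).encard :=
  Set.encard_congr (φ.mapNeighborSet v)

end Regular

end Multitriangulation

theorem mainTheorem2 (n : ℕ) (hn : 1 ≤ n) :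
    (∃ _ : (Multitriangulation.periodicFlipGraph (4 * n) n 2).LocallyFinite,
      (Multitriangulation.periodicFlipGraph (4 * n) n 2).IsRegularOfDegree (2 * (n - 1))) ∧
    (∃ _ : (Multitriangulation.cylFlipGraph n 2).LocallyFinite,
      (Multitriangulation.cylFlipGraph n 2).IsRegularOfDegree (2 * (n - 1))) ∧
    (∃ Φ : Multitriangulation.cylFlipGraph n 2 ≃g Multitriangulation.periodicFlipGraph (4 * n) n 2,
      ∀ (T : Multitriangulation.CylTriangulation n 2)
        (f : Multitriangulation.Edge (ZMod (4 * n))),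
        f ∈ (Φ T).1 ↔ ∃ e ∈ Multitriangulation.lift T.1,
          f.1 = e.1.map (fun i : ℤ => (i : ZMod (4 * n)))) := by
  have : NeZero n := ⟨by omega⟩
  refine ⟨Multitriangulation.exists_isRegularOfDegree fun T => ?_,
    Multitriangulation.exists_isRegularOfDegree Multitriangulation.encard_neighborSet_cylFlipGraph,
    Multitriangulation.wrapIso n, Multitriangulation.mem_wrapIso_iff⟩
  rw [Multitriangulation.encard_neighborSet_eq (Multitriangulation.wrapIso n).symm,
    Multitriangulation.encard_neighborSet_cylFlipGraph]
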